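/- \textbf{Setting.} Let $q$ be even. Represent a point $P=(y_0,\dots,y_5)$ of $\mathrm{PG}(5,q)$ by the symmetric matrix $$M_P=\begin{bmatrix} y_0&y_1&y_2\\ y_1&y_3&y_4\\ y_2&y_4&y_5\end{bmatrix};$$ the rank of $P$ is the rank of $M_P$. Let $\nu:\mathrm{PG}(2,q)\to\mathrm{PG}(5,q)$, $(u_0,u_1,u_2)\mapsto(u_0^2,u_0u_1,u_0u_2,u_1^2,u_1u_2,u_2^2)$, be the Veronese embedding, $\mathcal V(\mathbb F_q)$ its image (the Veronese surface), and call the images under $\nu$ of the lines of $\mathrm{PG}(2,q)$ the conics of $\mathcal V(\mathbb F_q)$. Let $\pi_{\mathcal N}=\mathcal Z(Y_0,Y_3,Y_5)$ be the nucleus plane. Let $K\le\mathrm{PGL}(6,q)$ be the image of $\mathrm{PGL}(3,q)$ under $\alpha$, where for $A\in\mathrm{GL}(3,q)$ the projectivity $\alpha(\phi_A)$ maps the point with matrix $M$ to the point with matrix $AMA^T$. Let $\mathcal H_1$ be the set of hyperplanes $\mathcal Z(a_{00}Y_0+a_{01}Y_1+a_{02}Y_2+a_{11}Y_3+a_{12}Y_4+a_{22}Y_5)$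 for which $\sum_{i\le j}a_{ij}X_iX_j$ is the square of a nonzero linear form (double lines). For a point $P\in\pi_{\mathcal N}$ let $H(P)$ be the unique hyperplane in $\mathcal H_1$ containing the conic of $\mathcal V(\mathbb F_q)$ whose plane passes through $P$. For a plane $\pi$ meeting $\pi_{\mathcal N}$ in exactly one point let $H(\pi)$ be the unique hyperplane in $\mathcal H_1$ containing $\pi$. For a plane $\pi$ let $OD_0(\pi)=[r_1,r_{2,n},r_{2,s},r_3]$, where $r_1$ and $r_3$ are the numbers of points of rank $1$ and rank $3$ in $\pi$, and $r_{2,n}$ and $r_{2,s}$ are the numbers of points of rank $2$ in $\pi\cap\pi_{\mathcal N}$ and in $\pi\setminus\pi_{\mathcal N}$, respectively. Let $\operatorname{Tr}$ be the trace map from $\mathbb F_q$ to $\mathbb F_2$. \textbf{Theorem.} The planes $\pi$ of $\mathrm{PG}(5,q)$ that are disjoint from $\mathcal V(\mathbb F_q)$ and meet $\pi_{\mathcal N}$ in exactly one point $P$, with $H(P)\ne H(\pi)$, form exactly three (pairwise distinct) $K$-orbits $\Sigma_{21},\Sigma_{22},\Sigma_{23}$. They are represented by the planes consisting of the points with matrices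 $$\Sigma_{21}:\begin{bmatrix} x&x+az&0\\ x+az&z&y\\ 0&y&0\end{bmatrix},\qquad \Sigma_{22}:\begin{bmatrix} x&x+z&z\\ x+z&z&y\\ z&y&0\end{bmatrix},\qquad \Sigma_{23}:\begin{bmatrix} x&az&x\\ az&z&y\\ x&y&0\end{bmatrix},$$ $(x,y,z)\in\mathbb F_q^3\setminus\{0\}$, where in $\Sigma_{21}$ and in $\Sigma_{23}$ the parameter $a\in\mathbb F_q$ is any element with $\operatorname{Tr}(a)=1$ (such elements exist, and the orbit does not depend on the choice). Every plane in the respective orbit has $$OD_0(\Sigma_{21})=[0,1,2q,q^2-q],\qquad OD_0(\Sigma_{22})=[0,1,q,q^2],\qquad OD_0(\Sigma_{23})=[0,1,2q,q^2-q].$$ -/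

import Mathlib

open scoped LinearAlgebra.Projectivization MatrixGroups Matrix Pointwise

set_option linter.unusedSectionVars false

namespace Veronese

section

variable (F : Type*) [Field F]

/-- The points of the plane `PG(2,q)`. -/
abbrev PG2 := ℙ F (Fin 3 → F)

/-- The points of `PG(5,q)`, with coordinates `(Y₀,…,Y₅)`. -/
abbrev PG5 := ℙ F (Fin 6 → F)

/-- The subspaces of `PG(2,q)`. -/
abbrev Subspace2 := Projectivization.Subspace F (Fin 3 → F)

/-- The subspaces of `PG(5,q)`. -/
abbrev Subspace5 := Projectivization.Subspace F (Fin 6 → F)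

variable {F}

/-- A line of `PG(2,q)`: its vector space has dimension two. -/
def IsLine (L : Subspace2 F) : Prop :=
  Module.finrank F (Projectivization.Subspace.submodule L) = 2

/-- A plane of `PG(5,q)`: its vector space has dimension three. -/
def IsPlane (W : Subspace5 F) : Prop :=
  Module.finrank F (Projectivization.Subspace.submodule W) = 3

/-- The symmetric `3 × 3` matrix of a coordinate vector of `PG(5,q)`. -/
def symMat (v : Fin 6 → F) : Matrix (Fin 3) (Fin 3) F :=
  !![v 0, v 1, v 2; v 1, v 3, v 4; v 2, v 4, v 5]

/-- The coordinate vector of a symmetric `3 × 3` matrix. -/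
def symCoord (M : Matrix (Fin 3) (Fin 3) F) : Fin 6 → F :=
  ![M 0 0, M 0 1, M 0 2, M 1 1, M 1 2, M 2 2]

@[simp] lemma symCoord_symMat (v : Fin 6 → F) : symCoord (symMat v) = v := by
  ext i; fin_cases i <;> rfl

lemma symMat_symCoord {M : Matrix (Fin 3) (Fin 3) F} (hM : Mᵀ = M) :
    symMat (symCoord M) = M := by
  have h (i j) : M i j = M j i := by rw [← Matrix.transpose_apply M, hM]
  ext i j
  fin_cases i <;> fin_cases j <;> simp [symMat, symCoord, h 1 0, h 2 0, h 2 1]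

lemma symMat_transpose (v : Fin 6 → F) : (symMat v)ᵀ = symMat v := by
  ext i j; fin_cases i <;> fin_cases j <;> rfl

lemma symMat_add (v w : Fin 6 → F) : symMat (v + w) = symMat v + symMat w := by
  ext i j; fin_cases i <;> fin_cases j <;> rfl

lemma symMat_smul (c : F) (v : Fin 6 → F) : symMat (c • v) = c • symMat v := by
  ext i j; fin_cases i <;> fin_cases j <;> rfl

lemma symCoord_add (M N : Matrix (Fin 3) (Fin 3) F) :
    symCoord (M + N) = symCoord M + symCoord N := by
  ext i; fin_cases i <;> rfl

lemma symCoord_smul (c : F) (M : Matrix (Fin 3) (Fin 3) F) :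
    symCoord (c • M) = c • symCoord M := by
  ext i; fin_cases i <;> rfl

/-! ### The group `K` -/

/-- The linear map `M ↦ A M Aᵀ` in the coordinates of `PG(5,q)`. -/
def congrLin (A : Matrix (Fin 3) (Fin 3) F) : (Fin 6 → F) →ₗ[F] (Fin 6 → F) where
  toFun v := symCoord (A * symMat v * Aᵀ)
  map_add' v w := by simp [symMat_add, mul_add, add_mul, symCoord_add]
  map_smul' c v := by simp [symMat_smul, symCoord_smul]

/-- `congrLin` as a homomorphism into `6 × 6` matrices. -/
def congrHom : Matrix (Fin 3) (Fin 3) F →* Matrix (Fin 6) (Fin 6) F where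
  toFun A := LinearMap.toMatrix' (congrLin A)
  map_one' := by
    have h : congrLin (1 : Matrix (Fin 3) (Fin 3) F) = LinearMap.id :=
      LinearMap.ext fun v => by simp [congrLin]
    rw [h, LinearMap.toMatrix'_id]
  map_mul' A B := by
    rw [← LinearMap.toMatrix'_comp]
    congr 1
    refine LinearMap.ext fun v => ?_
    have h : (B * symMat v * Bᵀ)ᵀ = B * symMat v * Bᵀ := by
      simp [Matrix.transpose_mul, symMat_transpose, mul_assoc]
    change symCoord (A * B * symMat v * (A * B)ᵀ) =
      symCoord (A * symMat (symCoord (B * symMat v * Bᵀ)) * Aᵀ)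
    rw [symMat_symCoord h]
    simp [Matrix.transpose_mul, mul_assoc]

lemma congrHom_scalar (u : Fˣ) :
    Units.map congrHom (Matrix.GeneralLinearGroup.scalar (Fin 3) u) =
      Matrix.GeneralLinearGroup.scalar (Fin 6) (u * u) := by
  apply Units.ext
  have h : congrLin ((Matrix.scalar (Fin 3)) (u : F)) =
      Matrix.toLin' ((Matrix.scalar (Fin 6)) ((u : F) * u)) := by
    refine LinearMap.ext fun v => ?_
    ext i
    fin_cases i <;>
      simp [congrLin, symCoord, symMat, Matrix.mul_apply,
        Matrix.diagonal_apply, Matrix.mulVec_diagonal] <;> ring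
  change LinearMap.toMatrix' (congrLin ((Matrix.scalar (Fin 3)) (u : F))) =
    (Matrix.scalar (Fin 6)) ((u : F) * u)
  rw [h, LinearMap.toMatrix'_toLin']

/-- The homomorphism `α : PGL(3,q) → PGL(6,q)`, `M_{α(φ_A)(P)} = A M_P Aᵀ`. -/
def alpha : PGL(3, F) →* PGL(6, F) :=
  Matrix.ProjGenLinGroup.lift (Matrix.ProjGenLinGroup.mk.comp (Units.map congrHom)) (by
    ext u
    simp [congrHom_scalar])

lemma alpha_mk_smul_mk (A : GL (Fin 3) F) {v : Fin 6 → F} (hv : v ≠ 0) :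
    ∃ hw : symCoord ((A : Matrix (Fin 3) (Fin 3) F) * symMat v *
        (A : Matrix (Fin 3) (Fin 3) F)ᵀ) ≠ 0,
      (alpha (Matrix.ProjGenLinGroup.mk A)) • Projectivization.mk F v hv =
        Projectivization.mk F _ hw := by
  have h : (Units.map (congrHom (F := F)) A) • v = symCoord ((A : Matrix (Fin 3) (Fin 3) F) *
      symMat v * (A : Matrix (Fin 3) (Fin 3) F)ᵀ) := by
    change (LinearMap.toMatrix' (congrLin (A : Matrix (Fin 3) (Fin 3) F))) *ᵥ v = _
    rw [LinearMap.toMatrix'_mulVec]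
    rfl
  have hw := (smul_ne_zero_iff_ne (Units.map (congrHom (F := F)) A)).2 hv
  simp_rw [← h]
  exact ⟨hw, rfl⟩

variable (F) in
/-- The group `K = α(PGL(3,q)) ≤ PGL(6,q)`. -/
def K : Subgroup PGL(6, F) := (alpha (F := F)).range

/-! ### The Veronese surface, its conics and the nucleus plane -/

/-- The Veronese map on vectors. -/
def nuVec (u : Fin 3 → F) : Fin 6 → F :=
  ![u 0 ^ 2, u 0 * u 1, u 0 * u 2, u 1 ^ 2, u 1 * u 2, u 2 ^ 2]

lemma nuVec_ne_zero {u : Fin 3 → F} (hu : u ≠ 0) : nuVec u ≠ 0 := by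
  intro h
  apply hu
  have h0 := congrFun h 0
  have h3 := congrFun h 3
  have h5 := congrFun h 5
  simp [nuVec] at h0 h3 h5
  ext i; fin_cases i <;> simp [h0, h3, h5]

lemma nuVec_smul (t : F) (u : Fin 3 → F) : nuVec (t • u) = (t ^ 2) • nuVec u := by
  ext i; fin_cases i <;> simp [nuVec] <;> ring

/-- The Veronese embedding `ν : PG(2,q) → PG(5,q)`. -/
def nu : PG2 F → PG5 F :=
  Projectivization.lift (fun u => Projectivization.mk F (nuVec u.1) (nuVec_ne_zero u.2)) (by
    rintro a b t h
    rw [Projectivization.mk_eq_mk_iff']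
    exact ⟨t ^ 2, by rw [h, nuVec_smul]⟩)

variable (F) in
/-- The Veronese surface `𝒱(𝔽_q)`. -/
def surface : Set (PG5 F) := Set.range nu

/-- The conics of the Veronese surface: the images under `ν` of the lines of `PG(2,q)`. -/
def IsConic (C : Set (PG5 F)) : Prop := ∃ L : Subspace2 F, IsLine L ∧ C = nu '' (L : Set (PG2 F))

variable (F) in
/-- The nucleus plane `𝒵(Y₀, Y₃, Y₅)`. -/
def nucleusPlane : Subspace5 F :=
  Submodule.projectivization
    { carrier := {y | y 0 = 0 ∧ y 3 = 0 ∧ y 5 = 0}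
      add_mem' := by
        rintro a b ⟨ha, ha', ha''⟩ ⟨hb, hb', hb''⟩
        simp [ha, ha', ha'', hb, hb', hb'']
      zero_mem' := by simp
      smul_mem' := by
        rintro c a ⟨ha, ha', ha''⟩
        simp [ha, ha', ha''] }

/-! ### Point-orbit distributions -/

/-- The rank of a point of `PG(5,q)`. -/
noncomputable def pointRank (P : PG5 F) : ℕ := (symMat P.rep).rank

/-- The point-orbit distribution `[r₁, r₂ₙ, r₂ₛ, r₃]` of a set of points of `PG(5,q)`. -/
noncomputable def OD0 (S : Set (PG5 F)) : Fin 4 → ℕ :=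
  ![{P ∈ S | pointRank P = 1}.ncard,
    {P ∈ S | pointRank P = 2 ∧ P ∈ nucleusPlane F}.ncard,
    {P ∈ S | pointRank P = 2 ∧ P ∉ nucleusPlane F}.ncard,
    {P ∈ S | pointRank P = 3}.ncard]

/-! ### Hyperplanes corresponding to double lines -/

/-- The hyperplane `δ(𝒵(f)) = 𝒵(a₀₀Y₀ + a₀₁Y₁ + a₀₂Y₂ + a₁₁Y₃ + a₁₂Y₄ + a₂₂Y₅)` of the conic with
equation `f = ∑_{i ≤ j} aᵢⱼ Xᵢ Xⱼ`, where `a = (a₀₀, a₀₁, a₀₂, a₁₁, a₁₂, a₂₂)`. -/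
def delta (a : Fin 6 → F) : Subspace5 F :=
  Submodule.projectivization (LinearMap.ker (dotProductBilin F F a))

/-- The coefficients of the quadratic form `(c₀X₀ + c₁X₁ + c₂X₂)²`. -/
def squareForm (c : Fin 3 → F) : Fin 6 → F :=
  ![c 0 ^ 2, 2 * c 0 * c 1, 2 * c 0 * c 2, c 1 ^ 2, 2 * c 1 * c 2, c 2 ^ 2]

variable (F) in
/-- The set `ℋ₁` of hyperplanes corresponding to double lines. -/
def H1 : Set (Subspace5 F) := {H | ∃ c : Fin 3 → F, c ≠ 0 ∧ H = delta (squareForm c)}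

lemma mk_mem_delta {a v : Fin 6 → F} (hv : v ≠ 0) :
    Projectivization.mk F v hv ∈ delta a ↔ a ⬝ᵥ v = 0 := by
  rw [delta, Submodule.mk_mem_projectivization_iff]
  simp

lemma squareForm_dotProduct [CharP F 2] (c : Fin 3 → F) (v : Fin 6 → F) :
    squareForm c ⬝ᵥ v = c 0 ^ 2 * v 0 + c 1 ^ 2 * v 3 + c 2 ^ 2 * v 5 := by
  have h2 : (2 : F) = 0 := CharTwo.two_eq_zero
  simp [squareForm, dotProduct, Fin.sum_univ_succ, h2]
  ring

lemma span_le_of_subset {S : Set (PG5 F)} {W : Subspace5 F} (h : S ⊆ W) {P : PG5 F}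
    (hP : P ∈ Projectivization.Subspace.span S) : P ∈ W :=
  (Projectivization.Subspace.span_le_subspace_iff.2 h) hP

/-- For `P` in the nucleus plane there is a unique hyperplane of `ℋ₁` containing the conic `𝒞(P)`
whose plane passes through `P`. -/
lemma existsUnique_hyperplaneOfPoint [CharP F 2] {P : PG5 F} (hP : P ∈ nucleusPlane F) :
    ∃! H : Subspace5 F, H ∈ H1 F ∧
      ∃ C, IsConic C ∧ P ∈ Projectivization.Subspace.span C ∧ C ⊆ (H : Set (PG5 F)) := by
  have h2 : (2 : F) = 0 := CharTwo.two_eq_zero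
  induction P using Projectivization.ind with
  | h p hp =>
  obtain ⟨h0, h3, h5⟩ : p 0 = 0 ∧ p 3 = 0 ∧ p 5 = 0 := hP
  set n : Fin 3 → F := ![p 4, p 2, p 1] with hn
  have hn0 : n ≠ 0 := by
    intro h
    apply hp
    have e0 := congrFun h 0
    have e1 := congrFun h 1
    have e2 := congrFun h 2
    simp [hn] at e0 e1 e2
    ext i; fin_cases i <;> simp [h0, h3, h5, e0, e1, e2]
  refine ⟨delta (squareForm n), ⟨⟨n, hn0, rfl⟩, ?_⟩, ?_⟩
  · set L : Subspace2 F :=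
      Submodule.projectivization (LinearMap.ker (dotProductBilin F F n)) with hL
    refine ⟨nu '' L, ⟨L, ?_, rfl⟩, ?_, ?_⟩
    · have hne : dotProductBilin F F n ≠ 0 := by
        intro h
        apply hn0
        ext i
        simpa using LinearMap.congr_fun h (Pi.single i 1)
      have := Module.Dual.finrank_ker_add_one_of_ne_zero (K := F) (f := dotProductBilin F F n) hne
      rw [Module.finrank_fin_fun] at this
      rw [IsLine, hL, OrderIso.apply_symm_apply]
      omega
    · rw [Projectivization.Subspace.mem_span]
      intro W hW
      rw [← Projectivization.Subspace.mem_submodule_iff _ hp]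
      have hmem : ∀ u : Fin 3 → F, n ⬝ᵥ u = 0 →
          nuVec u ∈ Projectivization.Subspace.submodule W := by
        intro u hu
        rcases eq_or_ne u 0 with rfl | hu0
        · have : nuVec (0 : Fin 3 → F) = 0 := by ext i; fin_cases i <;> simp [nuVec]
          rw [this]; exact Submodule.zero_mem _
        · rw [Projectivization.Subspace.mem_submodule_iff _ (nuVec_ne_zero hu0)]
          apply hW
          refine ⟨Projectivization.mk F u hu0, ?_, rfl⟩
          change u ∈ LinearMap.ker (dotProductBilin F F n)
          simpa using hu
      have key : ∀ (u w : Fin 3 → F) (t : F), t ≠ 0 → n ⬝ᵥ u = 0 → n ⬝ᵥ w = 0 →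
          nuVec (u + w) - nuVec u - nuVec w = t • p →
          p ∈ Projectivization.Subspace.submodule W := by
        intro u w t ht hu hw h
        rw [← Submodule.smul_mem_iff _ ht, ← h]
        refine Submodule.sub_mem _ (Submodule.sub_mem _ (hmem _ ?_) (hmem _ hu)) (hmem _ hw)
        rw [dotProduct_add, hu, hw, add_zero]
      by_cases h4 : p 4 = 0
      · by_cases h2' : p 2 = 0
        · have h1 : p 1 ≠ 0 := by
            intro h1
            apply hn0
            ext i; fin_cases i <;> simp [hn, h4, h2', h1]
          refine key ![1, 0, 0] ![0, p 1, 0] 1 one_ne_zero ?_ ?_ ?_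
          · simp [hn, h4, dotProduct, Fin.sum_univ_succ]
          · simp [hn, h2', dotProduct, Fin.sum_univ_succ]
          · ext i; fin_cases i <;> simp [nuVec, h0, h3, h5, h4, h2']
        · refine key ![1, 0, 0] ![0, p 1, p 2] 1 one_ne_zero ?_ ?_ ?_
          · simp [hn, h4, dotProduct, Fin.sum_univ_succ]
          · simp [hn, dotProduct, Fin.sum_univ_succ]
            linear_combination (p 1 * p 2) * h2
          · ext i; fin_cases i <;> simp [nuVec, h0, h3, h5, h4]
      · refine key ![p 2, p 4, 0] ![p 1, 0, p 4] (p 4) h4 ?_ ?_ ?_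
        · simp [hn, dotProduct, Fin.sum_univ_succ]
          linear_combination (p 2 * p 4) * h2
        · simp [hn, dotProduct, Fin.sum_univ_succ]
          linear_combination (p 1 * p 4) * h2
        · ext i
          fin_cases i <;> simp [nuVec, h0, h3, h5] <;>
            first
            | ring1
            | linear_combination (p 1 * p 2) * h2
    · rintro _ ⟨Q, hQ, rfl⟩
      induction Q using Projectivization.ind with
      | h u hu =>
      have hu' : n ⬝ᵥ u = 0 := by
        change u ∈ LinearMap.ker (dotProductBilin F F n) at hQ
        simpa using hQ
      change Projectivization.mk F (nuVec u) (nuVec_ne_zero hu) ∈ delta (squareForm n)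
      rw [mk_mem_delta, squareForm_dotProduct]
      simp only [dotProduct, Fin.sum_univ_three] at hu'
      simp only [nuVec, Matrix.cons_val]
      linear_combination (n 0 * u 0 + n 1 * u 1 + n 2 * u 2) * hu' -
        (n 0 * u 0 * (n 1 * u 1) + n 0 * u 0 * (n 2 * u 2) + n 1 * u 1 * (n 2 * u 2)) * h2
  · rintro H ⟨⟨c, hc, rfl⟩, C, ⟨L, -, rfl⟩, hPC, hCH⟩
    -- every point of the conic is annihilated by `c`, hence so is `P`
    let A : Submodule F (Fin 6 → F) :=
      { carrier := {v | symMat v *ᵥ c = 0}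
        add_mem' := by
          intro a b ha hb
          change symMat (a + b) *ᵥ c = 0
          rw [symMat_add, Matrix.add_mulVec, show symMat a *ᵥ c = 0 from ha,
            show symMat b *ᵥ c = 0 from hb, add_zero]
        zero_mem' := by
          change symMat 0 *ᵥ c = 0
          rw [show symMat (0 : Fin 6 → F) = 0 by
            ext i j; fin_cases i <;> fin_cases j <;> rfl, Matrix.zero_mulVec]
        smul_mem' := by
          intro t a ha
          change symMat (t • a) *ᵥ c = 0
          rw [symMat_smul, Matrix.smul_mulVec, show symMat a *ᵥ c = 0 from ha, smul_zero] }
    have hsub : nu '' (L : Set (PG2 F)) ⊆ (Submodule.projectivization A : Subspace5 F) := by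
      rintro _ ⟨Q, hQ, rfl⟩
      have hd := hCH ⟨Q, hQ, rfl⟩
      induction Q using Projectivization.ind with
      | h u hu =>
      change Projectivization.mk F (nuVec u) (nuVec_ne_zero hu) ∈ delta (squareForm c) at hd
      rw [mk_mem_delta, squareForm_dotProduct] at hd
      simp only [nuVec, Matrix.cons_val] at hd
      have hcu : c 0 * u 0 + c 1 * u 1 + c 2 * u 2 = 0 := by
        apply pow_eq_zero_iff (two_ne_zero) |>.1
        linear_combination hd +
          (c 0 * u 0 * (c 1 * u 1) + c 0 * u 0 * (c 2 * u 2) + c 1 * u 1 * (c 2 * u 2)) * h2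
      change symMat (nuVec u) *ᵥ c = 0
      ext i
      fin_cases i <;> simp [symMat, nuVec, Matrix.mulVec, dotProduct, Fin.sum_univ_succ]
      · linear_combination u 0 * hcu
      · linear_combination u 1 * hcu
      · linear_combination u 2 * hcu
    have hpA : symMat p *ᵥ c = 0 := span_le_of_subset hsub hPC
    have e0 := congrFun hpA 0
    have e1 := congrFun hpA 1
    have e2 := congrFun hpA 2
    simp [symMat, Matrix.mulVec, dotProduct, Fin.sum_univ_succ, h0, h3, h5] at e0 e1 e2
    obtain ⟨t, ht⟩ : ∃ t : F, c = t • n := by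
      by_cases h4 : p 4 = 0
      · by_cases h2' : p 2 = 0
        · have h1 : p 1 ≠ 0 := by
            intro h1
            apply hn0
            ext i; fin_cases i <;> simp [hn, h4, h2', h1]
          refine ⟨c 2 / p 1, ?_⟩
          ext i
          fin_cases i <;> simp [hn, h4, h2'] <;> try field_simp
          · simpa [h4, h1] using e1
          · simpa [h2', h1] using e0
        · refine ⟨c 1 / p 2, ?_⟩
          ext i
          fin_cases i <;> simp [hn, h4] <;> try field_simp
          · simpa [h4, h2'] using e2
          · linear_combination e0 - (c 1 * p 1) * h2
      · refine ⟨c 0 / p 4, ?_⟩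
        ext i
        fin_cases i <;> simp [hn] <;> try field_simp
        · linear_combination e2 - (c 0 * p 2) * h2
        · linear_combination e1 - (c 0 * p 1) * h2
    have ht0 : t ≠ 0 := by rintro rfl; exact hc (by simp [ht])
    apply SetLike.ext
    intro Q
    induction Q using Projectivization.ind with
    | h v hv =>
    rw [mk_mem_delta, mk_mem_delta, squareForm_dotProduct, squareForm_dotProduct, ht]
    have : (t • n) 0 ^ 2 * v 0 + (t • n) 1 ^ 2 * v 3 + (t • n) 2 ^ 2 * v 5 =
        t ^ 2 * (n 0 ^ 2 * v 0 + n 1 ^ 2 * v 3 + n 2 ^ 2 * v 5) := by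
      simp only [Pi.smul_apply, smul_eq_mul]; ring
    rw [this]
    simp [ht0]

/-- A plane meeting the nucleus plane in a single point lies in a unique hyperplane of `ℋ₁`. -/
lemma existsUnique_hyperplaneOfPlane [Finite F] [CharP F 2] {W : Subspace5 F} (hW : IsPlane W)
    {P : PG5 F} (hP : (W : Set (PG5 F)) ∩ nucleusPlane F = {P}) :
    ∃! H : Subspace5 F, H ∈ H1 F ∧ W ≤ H := by
  let φ : (Fin 6 → F) →ₗ[F] (Fin 3 → F) :=
    { toFun v := ![v 0, v 3, v 5]
      map_add' a b := by ext i; fin_cases i <;> rfl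
      map_smul' t a := by ext i; fin_cases i <;> rfl }
  set S := Projectivization.Subspace.submodule W with hS
  have hmemN : ∀ v : Fin 6 → F, ∀ hv : v ≠ 0,
      Projectivization.mk F v hv ∈ nucleusPlane F ↔ φ v = 0 := by
    intro v hv
    change (v 0 = 0 ∧ v 3 = 0 ∧ v 5 = 0) ↔ _
    constructor
    · rintro ⟨a, b, c⟩
      ext i; fin_cases i <;> simp [φ, a, b, c]
    · intro h
      exact ⟨congrFun h 0, congrFun h 1, congrFun h 2⟩
  have hker : Module.finrank F (LinearMap.ker (φ.domRestrict S)) = 1 := by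
    have hPm : P ∈ (W : Set (PG5 F)) ∩ nucleusPlane F := by rw [hP]; rfl
    induction P using Projectivization.ind with
    | h p hp =>
    have hpS : p ∈ S := (Projectivization.Subspace.mem_submodule_iff _ hp).2 hPm.1
    have hpφ : φ p = 0 := (hmemN p hp).1 hPm.2
    refine finrank_eq_one (⟨⟨p, hpS⟩, hpφ⟩ : LinearMap.ker (φ.domRestrict S)) ?_ ?_
    · intro h
      have h' : (⟨p, hpS⟩ : S) = 0 := congrArg Subtype.val h
      exact hp (congrArg Subtype.val h')
    · rintro ⟨⟨v, hvS⟩, hvφ⟩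
      rcases eq_or_ne v 0 with rfl | hv
      · exact ⟨0, by rw [zero_smul]; rfl⟩
      · have : Projectivization.mk F v hv ∈ (W : Set (PG5 F)) ∩ nucleusPlane F :=
          ⟨(Projectivization.Subspace.mem_submodule_iff _ hv).1 hvS, (hmemN v hv).2 hvφ⟩
        rw [hP, Set.mem_singleton_iff, Projectivization.mk_eq_mk_iff'] at this
        obtain ⟨a, ha⟩ := this
        exact ⟨a, by apply Subtype.ext; apply Subtype.ext; exact ha⟩
  have hrange : Module.finrank F (S.map φ) = 2 := by
    have h := LinearMap.finrank_range_add_finrank_ker (φ.domRestrict S)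
    rw [hker, LinearMap.range_domRestrict, show Module.finrank F S = 3 from hW] at h
    omega
  have hdual : ∀ f : (Fin 3 → F) →ₗ[F] F, f ≠ 0 → S.map φ ≤ LinearMap.ker f →
      LinearMap.ker f = S.map φ := by
    intro f hf hle
    have := Module.Dual.finrank_ker_add_one_of_ne_zero (K := F) (f := f) hf
    rw [Module.finrank_fin_fun] at this
    exact (Submodule.eq_of_le_of_finrank_eq hle (by omega)).symm
  have hdelta : ∀ (c : Fin 3 → F) (v : Fin 6 → F) (hv : v ≠ 0),
      Projectivization.mk F v hv ∈ delta (squareForm c) ↔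
        dotProductBilin F F (fun i => c i ^ 2) (φ v) = 0 := by
    intro c v hv
    rw [mk_mem_delta, squareForm_dotProduct]
    simp [dotProduct, Fin.sum_univ_three, φ]
  have hle : ∀ c : Fin 3 → F, W ≤ delta (squareForm c) ↔
      S.map φ ≤ LinearMap.ker (dotProductBilin F F (fun i => c i ^ 2)) := by
    intro c
    constructor
    · rintro h _ ⟨v, hv, rfl⟩
      rcases eq_or_ne v 0 with rfl | hv0
      · simp
      · exact (hdelta c v hv0).1 (h ((Projectivization.Subspace.mem_submodule_iff _ hv0).1 hv))
    · intro h Q hQ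
      induction Q using Projectivization.ind with
      | h v hv =>
      exact (hdelta c v hv).2
        (h ⟨v, (Projectivization.Subspace.mem_submodule_iff _ hv).2 hQ, rfl⟩)
  have hne : ∀ c : Fin 3 → F, c ≠ 0 → dotProductBilin F F (fun i => c i ^ 2) ≠ 0 := by
    intro c hc h
    apply hc
    ext i
    simpa using LinearMap.congr_fun h (Pi.single i 1)
  obtain ⟨f, hf, hfle⟩ := Submodule.exists_le_ker_of_lt_top (S.map φ) (by
    rw [lt_top_iff_ne_top]
    intro h
    rw [h, finrank_top, Module.finrank_fin_fun] at hrange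
    omega)
  have : Fact (Nat.Prime 2) := ⟨Nat.prime_two⟩
  choose r hr using (fun x : F => (surjective_frobenius F 2) x)
  let c : Fin 3 → F := fun i => r (f (Pi.single i 1))
  have hcf : dotProductBilin F F (fun i => c i ^ 2) = f := by
    apply LinearMap.pi_ext'
    intro i
    apply LinearMap.ext_ring
    have := hr (f (Pi.single i 1))
    rw [frobenius_def] at this
    simp [c, this]
  have hc : c ≠ 0 := by
    intro h
    apply hf
    rw [← hcf, h]
    refine LinearMap.ext fun v => ?_
    simp [dotProduct]
  refine ⟨delta (squareForm c), ⟨⟨c, hc, rfl⟩, (hle c).2 (by rw [hcf]; exact hfle)⟩, ?_⟩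
  rintro H ⟨⟨d, hd, rfl⟩, hWd⟩
  have h1 := hdual _ (hne d hd) ((hle d).1 hWd)
  have h2 := hdual f hf hfle
  apply SetLike.ext
  intro Q
  induction Q using Projectivization.ind with
  | h v hv =>
  rw [hdelta, hdelta, ← LinearMap.mem_ker, ← LinearMap.mem_ker, h1, hcf, h2]

/-- `H(P)`, for a point `P` of the nucleus plane: the unique hyperplane of `ℋ₁` containing the conic
`𝒞(P)`, the conic whose plane passes through `P`. -/
noncomputable def hyperplaneOfPoint [CharP F 2] (P : PG5 F) (hP : P ∈ nucleusPlane F) :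
    Subspace5 F :=
  (existsUnique_hyperplaneOfPoint hP).choose

/-- `H(π)`, for a plane `π` meeting the nucleus plane in a single point: the unique hyperplane of
`ℋ₁` containing `π`. -/
noncomputable def hyperplaneOfPlane [Finite F] [CharP F 2] (W : Subspace5 F) (hW : IsPlane W)
    (P : PG5 F) (hP : (W : Set (PG5 F)) ∩ nucleusPlane F = {P}) : Subspace5 F :=
  (existsUnique_hyperplaneOfPlane hW hP).choose

lemma mem_nucleusPlane_of_inter_eq {W : Subspace5 F} {P : PG5 F}
    (hP : (W : Set (PG5 F)) ∩ nucleusPlane F = {P}) : P ∈ nucleusPlane F :=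
  (hP.ge rfl).2

/-- The planes `π` disjoint from the Veronese surface and meeting the nucleus plane in a point `P`
such that `H(P) ≠ H(π)`. -/
def DifferentHyperplanes [Finite F] [CharP F 2] (W : Subspace5 F) : Prop :=
  ∃ hW : IsPlane W, Disjoint (W : Set (PG5 F)) (surface F) ∧
    ∃ (P : PG5 F) (hP : (W : Set (PG5 F)) ∩ nucleusPlane F = {P}),
      hyperplaneOfPoint P (mem_nucleusPlane_of_inter_eq hP) ≠ hyperplaneOfPlane W hW P hP

/-! ### The representatives -/

/-- The trace of `𝔽_q`, `q` even, to its prime field. -/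
noncomputable def absTrace [CharP F 2] (a : F) : ZMod 2 :=
  letI := ZMod.algebra F 2
  Algebra.trace (ZMod 2) F a

/-- The set of points of `PG(5,q)` represented by the matrices `m x y z`. -/
def matrixPoints (m : F → F → F → Matrix (Fin 3) (Fin 3) F) : Set (PG5 F) :=
  {P | ∃ x y z : F, symMat P.rep = m x y z}

/-- The representative of `Σ₂₁` with parameter `a`. -/
def rep21 (a : F) : Set (PG5 F) :=
  matrixPoints fun x y z => !![x, x + a * z, 0; x + a * z, z, y; 0, y, 0]

variable (F) in
/-- The representative of `Σ₂₂`. -/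
def rep22 : Set (PG5 F) :=
  matrixPoints fun x y z => !![x, x + z, z; x + z, z, y; z, y, 0]

/-- The representative of `Σ₂₃` with parameter `a`. -/
def rep23 (a : F) : Set (PG5 F) :=
  matrixPoints fun x y z => !![x, a * z, x; a * z, z, y; x, y, 0]

/-- The `K`-orbit of a set of points of `PG(5,q)`. -/
def orbitK (S : Set (PG5 F)) : Set (Set (PG5 F)) := MulAction.orbit (K F) S

end

end Veronese

namespace Veronese

variable {F : Type*} [Field F]

/-! In characteristic 2 the form `c ⬝ᵥ M *ᵥ c` sees only the diagonal of a symmetric `M`, so a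
hyperplane of `H1` is the set of `M` with `c ⬝ᵥ M *ᵥ c = 0` for some `c ≠ 0`. The points of the
nucleus plane are the alternating matrices; such a matrix has a one-dimensional kernel, and a
generator of it gives `H(P)`. Hence `H(P) ≠ H(π)` says that the vector `c` of `H(π)` is not in the
kernel of the matrix of `P` (`differentHyperplanes_iff`).

A basis adapted to that kernel and to `c` moves `P` to the fourth unit vector and `H(π)` to `Y₅ =
0`. The plane becomes `Y₁ = bY₀ + cY₃`, `Y₂ = dY₀ + eY₃`, `Y₅ = 0`
(`HasDifferentHyperplanes.exists_congrMap_eq_normalPlane`). Being disjoint from the Veronese surface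
then means that `xy = bx² + cy²` and `dx² + ey² = 0` have only the trivial common solution
(`hasDifferentHyperplanes_normalPlane_iff`). The matrices that fix `P` and `H(π)` still act on `(b,
c, d, e)` (`exists_congrMap_normalPlane_eq`). They lead to `Σ₂₂` if `e ≠ 0`, to `Σ₂₃` if `e = 0 ≠
d`, and to `Σ₂₁` if `d = e = 0`. In the last case disjointness is the irreducibility of `bx² + xy +
cy²`, that is, `Tr(bc) = 1`, by Artin–Schreier theory (`exists_eq_sq_add_self`).

The point counts reduce to counting zeros of the determinant on the `q² + q` points outside the
nucleus plane (`HasDifferentHyperplanes.OD0_eq`). They separate `Σ₂₂` from the other two orbits. For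
`Σ₂₁` and `Σ₂₃`, whose counts agree, the invariant is a line of matrices with a common kernel
vector: it exists in `Σ₂₁` and not in `Σ₂₃` (`congrMap_normalPlane_21_ne_23`). -/

/-! ### Planes as submodules and the action of `K` on them. -/

/-- The set of points of `PG(5,q)` spanned by vectors of a submodule. -/
def pointSet (U : Submodule F (Fin 6 → F)) : Set (PG5 F) :=
  (Submodule.projectivization U : Subspace5 F)

lemma mk_mem_pointSet {U : Submodule F (Fin 6 → F)} {v : Fin 6 → F} (hv : v ≠ 0) :
    Projectivization.mk F v hv ∈ pointSet U ↔ v ∈ U :=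
  Submodule.mk_mem_projectivization_iff U hv

lemma mem_pointSet_iff_rep {U : Submodule F (Fin 6 → F)} {P : PG5 F} :
    P ∈ pointSet U ↔ P.rep ∈ U := by
  rw [← mk_mem_pointSet P.rep_nonzero, P.mk_rep]

lemma pointSet_submodule (W : Subspace5 F) :
    pointSet (Projectivization.Subspace.submodule W) = (W : Set (PG5 F)) := by
  ext P
  induction P using Projectivization.ind with
  | h v hv => rw [mk_mem_pointSet, Projectivization.Subspace.mem_submodule_iff _ hv]; rfl

lemma pointSet_injective : Function.Injective (pointSet (F := F)) := by
  intro U V h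
  ext v
  rcases eq_or_ne v 0 with rfl | hv
  · simp
  · rw [← mk_mem_pointSet hv, h, mk_mem_pointSet]

lemma symMat_congrLin (A : Matrix (Fin 3) (Fin 3) F) (v : Fin 6 → F) :
    symMat (congrLin A v) = A * symMat v * Aᵀ := by
  refine symMat_symCoord ?_
  simp [Matrix.transpose_mul, symMat_transpose, mul_assoc]

lemma symMat_injective : Function.Injective (symMat (F := F)) :=
  Function.LeftInverse.injective symCoord_symMat

lemma congrLin_mul (A B : Matrix (Fin 3) (Fin 3) F) :
    congrLin (A * B) = congrLin A ∘ₗ congrLin B := by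
  refine LinearMap.ext fun v => symMat_injective ?_
  simp [symMat_congrLin, Matrix.transpose_mul, mul_assoc]

lemma congrLin_one : congrLin (1 : Matrix (Fin 3) (Fin 3) F) = LinearMap.id :=
  LinearMap.ext fun v => by simp [congrLin]

lemma congrLin_inv_apply (A : GL (Fin 3) F) (v : Fin 6 → F) :
    congrLin ((A⁻¹ : GL (Fin 3) F) : Matrix (Fin 3) (Fin 3) F)
      (congrLin (A : Matrix (Fin 3) (Fin 3) F) v) = v := by
  rw [← LinearMap.comp_apply, ← congrLin_mul, ← Units.val_mul, inv_mul_cancel, Units.val_one,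
    congrLin_one, LinearMap.id_apply]

lemma congrLin_injective (A : GL (Fin 3) F) :
    Function.Injective (congrLin (A : Matrix (Fin 3) (Fin 3) F)) :=
  Function.LeftInverse.injective (congrLin_inv_apply A)

/-- The matrix of `nuVec u` is `u uᵀ`, and `A (u uᵀ) Aᵀ = (Au)(Au)ᵀ`. -/
lemma congrLin_nuVec (A : Matrix (Fin 3) (Fin 3) F) (u : Fin 3 → F) :
    congrLin A (nuVec u) = nuVec (A *ᵥ u) := by
  have h (u : Fin 3 → F) : symMat (nuVec u) = Matrix.vecMulVec u u := by
    ext i j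
    fin_cases i <;> fin_cases j <;> simp [symMat, nuVec, Matrix.vecMulVec_apply] <;> ring
  apply symMat_injective
  rw [symMat_congrLin, h, h, Matrix.mul_vecMulVec, Matrix.vecMulVec_mul, Matrix.vecMul_transpose]

/-- The image of a submodule under `M ↦ A M Aᵀ`. -/
def congrMap (A : GL (Fin 3) F) (U : Submodule F (Fin 6 → F)) : Submodule F (Fin 6 → F) :=
  U.map (congrLin (A : Matrix (Fin 3) (Fin 3) F))

lemma congrLin_mem_congrMap (A : GL (Fin 3) F) {U : Submodule F (Fin 6 → F)} {v : Fin 6 → F} :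
    congrLin (A : Matrix (Fin 3) (Fin 3) F) v ∈ congrMap A U ↔ v ∈ U :=
  ⟨fun ⟨_, hw, h⟩ => congrLin_injective A h ▸ hw, fun h => ⟨v, h, rfl⟩⟩

lemma finrank_congrMap (A : GL (Fin 3) F) (U : Submodule F (Fin 6 → F)) :
    Module.finrank F (congrMap A U) = Module.finrank F U :=
  (Submodule.equivMapOfInjective _ (congrLin_injective A) U).finrank_eq.symm

lemma congrMap_mul (A B : GL (Fin 3) F) (U : Submodule F (Fin 6 → F)) :
    congrMap (A * B) U = congrMap A (congrMap B U) := by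
  rw [congrMap, Units.val_mul, congrLin_mul, Submodule.map_comp]
  rfl

lemma congrMap_inv_congrMap (A : GL (Fin 3) F) (U : Submodule F (Fin 6 → F)) :
    congrMap A⁻¹ (congrMap A U) = U := by
  rw [← congrMap_mul, inv_mul_cancel, congrMap, Units.val_one, congrLin_one, Submodule.map_id]

lemma alpha_smul_pointSet (A : GL (Fin 3) F) (U : Submodule F (Fin 6 → F)) :
    alpha (Matrix.ProjGenLinGroup.mk A) • pointSet U = pointSet (congrMap A U) := by
  have h (A : GL (Fin 3) F) (U : Submodule F (Fin 6 → F)) :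
      alpha (Matrix.ProjGenLinGroup.mk A) • pointSet U ⊆ pointSet (congrMap A U) := by
    rintro _ ⟨P, hP, rfl⟩
    induction P using Projectivization.ind with
    | h v hv =>
    obtain ⟨hw, h⟩ := alpha_mk_smul_mk A hv
    change alpha (Matrix.ProjGenLinGroup.mk A) • Projectivization.mk F v hv ∈ _
    rw [h, mk_mem_pointSet]
    exact ⟨v, (mk_mem_pointSet hv).1 hP, rfl⟩
  refine (h A U).antisymm ?_
  -- The reverse inclusion is the first one applied to `A⁻¹`.
  rw [Set.subset_smul_set_iff, ← map_inv, ← map_inv]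
  exact (h A⁻¹ _).trans_eq (by rw [congrMap_inv_congrMap])

lemma mem_orbitK_iff {S T : Set (PG5 F)} :
    S ∈ orbitK T ↔ ∃ A : GL (Fin 3) F, S = alpha (Matrix.ProjGenLinGroup.mk A) • T := by
  constructor
  · rintro ⟨⟨_, g, rfl⟩, rfl⟩
    obtain ⟨A, rfl⟩ := Matrix.ProjGenLinGroup.mk_surjective g
    exact ⟨A, rfl⟩
  · rintro ⟨A, rfl⟩
    exact ⟨⟨_, Matrix.ProjGenLinGroup.mk A, rfl⟩, rfl⟩

lemma mem_orbitK_pointSet_iff {S : Set (PG5 F)} {U : Submodule F (Fin 6 → F)} :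
    S ∈ orbitK (pointSet U) ↔ ∃ A : GL (Fin 3) F, S = pointSet (congrMap A U) := by
  simp_rw [mem_orbitK_iff, alpha_smul_pointSet]

lemma orbitK_pointSet_congrMap (A : GL (Fin 3) F) (U : Submodule F (Fin 6 → F)) :
    orbitK (pointSet (congrMap A U)) = orbitK (pointSet U) :=
  MulAction.orbit_eq_iff.2 (mem_orbitK_pointSet_iff.2 ⟨A, rfl⟩)

/-! ### The hyperplane condition in terms of vectors. -/

/-- The vectors of the nucleus plane: alternating matrices. -/
def IsNuclear (v : Fin 6 → F) : Prop := v 0 = 0 ∧ v 3 = 0 ∧ v 5 = 0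

lemma mk_mem_nucleusPlane {v : Fin 6 → F} (hv : v ≠ 0) :
    Projectivization.mk F v hv ∈ nucleusPlane F ↔ IsNuclear v :=
  Submodule.mk_mem_projectivization_iff _ hv

/-- For a point `ν(u)` of the hyperplane, `(c · u)² = 0`, so `u uᵀ c = 0`. Annihilating `c` is a
linear condition, so it passes from the conic to its span. -/
lemma symMat_mulVec_eq_zero_of_conic [CharP F 2] {p : Fin 6 → F} (hp : p ≠ 0) {c : Fin 3 → F}
    {C : Set (PG5 F)} (hC : IsConic C)
    (hPC : Projectivization.mk F p hp ∈ Projectivization.Subspace.span C)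
    (hCH : C ⊆ (delta (squareForm c) : Set (PG5 F))) : symMat p *ᵥ c = 0 := by
  have h2 : (2 : F) = 0 := CharTwo.two_eq_zero
  obtain ⟨L, -, rfl⟩ := hC
  let A : Submodule F (Fin 6 → F) :=
    { carrier := {v | symMat v *ᵥ c = 0}
      add_mem' := by
        intro a b ha hb
        change symMat (a + b) *ᵥ c = 0
        rw [symMat_add, Matrix.add_mulVec, show symMat a *ᵥ c = 0 from ha,
          show symMat b *ᵥ c = 0 from hb, add_zero]
      zero_mem' := by
        change symMat 0 *ᵥ c = 0
        rw [show symMat (0 : Fin 6 → F) = 0 by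
          ext i j; fin_cases i <;> fin_cases j <;> rfl, Matrix.zero_mulVec]
      smul_mem' := by
        intro t a ha
        change symMat (t • a) *ᵥ c = 0
        rw [symMat_smul, Matrix.smul_mulVec, show symMat a *ᵥ c = 0 from ha, smul_zero] }
  have hsub : nu '' (L : Set (PG2 F)) ⊆ (Submodule.projectivization A : Subspace5 F) := by
    rintro _ ⟨Q, hQ, rfl⟩
    have hd := hCH ⟨Q, hQ, rfl⟩
    induction Q using Projectivization.ind with
    | h u hu =>
    change Projectivization.mk F (nuVec u) (nuVec_ne_zero hu) ∈ delta (squareForm c) at hd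
    rw [mk_mem_delta, squareForm_dotProduct] at hd
    simp only [nuVec, Matrix.cons_val] at hd
    have hcu : c 0 * u 0 + c 1 * u 1 + c 2 * u 2 = 0 := by
      apply pow_eq_zero_iff (two_ne_zero) |>.1
      linear_combination hd +
        (c 0 * u 0 * (c 1 * u 1) + c 0 * u 0 * (c 2 * u 2) + c 1 * u 1 * (c 2 * u 2)) * h2
    change symMat (nuVec u) *ᵥ c = 0
    ext i
    fin_cases i <;> simp [symMat, nuVec, Matrix.mulVec, dotProduct, Fin.sum_univ_succ]
    · linear_combination u 0 * hcu
    · linear_combination u 1 * hcu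
    · linear_combination u 2 * hcu
  exact span_le_of_subset hsub hPC

/-- The kernel vector of an alternating matrix. -/
def kernelVec (p : Fin 6 → F) : Fin 3 → F := ![p 4, p 2, p 1]

/-- A nonzero alternating `3 × 3` matrix has rank 2. The cases choose a nonzero coordinate of
`kernelVec p` to divide by. -/
lemma exists_eq_smul_kernelVec [CharP F 2] {p : Fin 6 → F} (hp : p ≠ 0) (hN : IsNuclear p)
    {c : Fin 3 → F} (hc : symMat p *ᵥ c = 0) : ∃ t : F, c = t • kernelVec p := by
  have h2 : (2 : F) = 0 := CharTwo.two_eq_zero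
  obtain ⟨h0, h3, h5⟩ := hN
  have e0 := congrFun hc 0
  have e1 := congrFun hc 1
  have e2 := congrFun hc 2
  simp [symMat, Matrix.mulVec, dotProduct, Fin.sum_univ_succ, h0, h3, h5] at e0 e1 e2
  by_cases h4 : p 4 = 0
  · by_cases h2' : p 2 = 0
    · have h1 : p 1 ≠ 0 := by
        intro h1
        apply hp
        ext i; fin_cases i <;> simp [h0, h3, h5, h4, h2', h1]
      refine ⟨c 2 / p 1, ?_⟩
      ext i
      fin_cases i <;> simp [kernelVec, h4, h2'] <;> try field_simp
      · simpa [h4, h1] using e1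
      · simpa [h2', h1] using e0
    · refine ⟨c 1 / p 2, ?_⟩
      ext i
      fin_cases i <;> simp [kernelVec, h4] <;> try field_simp
      · simpa [h4, h2'] using e2
      · linear_combination e0 - (c 1 * p 1) * h2
  · refine ⟨c 0 / p 4, ?_⟩
    ext i
    fin_cases i <;> simp [kernelVec] <;> try field_simp
    · linear_combination e2 - (c 0 * p 2) * h2
    · linear_combination e1 - (c 0 * p 1) * h2

lemma delta_squareForm_smul [CharP F 2] {t : F} (ht : t ≠ 0) (c : Fin 3 → F) :
    delta (squareForm (t • c)) = delta (squareForm c) := by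
  apply SetLike.ext
  intro Q
  induction Q using Projectivization.ind with
  | h v hv =>
  rw [mk_mem_delta, mk_mem_delta, squareForm_dotProduct, squareForm_dotProduct]
  have : (t • c) 0 ^ 2 * v 0 + (t • c) 1 ^ 2 * v 3 + (t • c) 2 ^ 2 * v 5 =
      t ^ 2 * (c 0 ^ 2 * v 0 + c 1 ^ 2 * v 3 + c 2 ^ 2 * v 5) := by
    simp only [Pi.smul_apply, smul_eq_mul]; ring
  rw [this]
  simp [ht]

/-- The off-diagonal entries occur twice on the right and cancel. The right-hand form is the one
that transforms well under congruence. -/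
lemma squareForm_dotProduct_eq [CharP F 2] (c : Fin 3 → F) (v : Fin 6 → F) :
    squareForm c ⬝ᵥ v = c ⬝ᵥ symMat v *ᵥ c := by
  have h2 : (2 : F) = 0 := CharTwo.two_eq_zero
  rw [squareForm_dotProduct]
  simp [symMat, Matrix.mulVec, dotProduct, Fin.sum_univ_succ]
  linear_combination (-(c 0 * c 1 * v 1) - c 0 * c 2 * v 2 - c 1 * c 2 * v 4) * h2

/-- The vector form of `DifferentHyperplanes`. -/
def HasDifferentHyperplanes (U : Submodule F (Fin 6 → F)) : Prop :=
  Module.finrank F U = 3 ∧ (∀ u : Fin 3 → F, u ≠ 0 → nuVec u ∉ U) ∧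
    ∃ p ∈ U, p ≠ 0 ∧ IsNuclear p ∧ (∀ v ∈ U, IsNuclear v → ∃ t : F, v = t • p) ∧
      ∃ c : Fin 3 → F, (∀ v ∈ U, c ⬝ᵥ symMat v *ᵥ c = 0) ∧ symMat p *ᵥ c ≠ 0

lemma le_delta_iff [CharP F 2] {W : Subspace5 F} {c : Fin 3 → F} :
    W ≤ delta (squareForm c) ↔
      ∀ v ∈ Projectivization.Subspace.submodule W, c ⬝ᵥ symMat v *ᵥ c = 0 := by
  simp_rw [← squareForm_dotProduct_eq]
  constructor
  · intro h v hv
    rcases eq_or_ne v 0 with rfl | hv0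
    · simp
    · exact (mk_mem_delta hv0).1 (h ((Projectivization.Subspace.mem_submodule_iff _ hv0).1 hv))
  · intro h Q hQ
    induction Q using Projectivization.ind with
    | h v hv =>
    exact (mk_mem_delta hv).2 (h v ((Projectivization.Subspace.mem_submodule_iff _ hv).2 hQ))

lemma disjoint_surface_iff {W : Subspace5 F} :
    Disjoint (W : Set (PG5 F)) (surface F) ↔
      ∀ u : Fin 3 → F, u ≠ 0 → nuVec u ∉ Projectivization.Subspace.submodule W := by
  rw [Set.disjoint_right]
  constructor
  · intro h u hu hW
    exact h ⟨Projectivization.mk F u hu, rfl⟩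
      ((Projectivization.Subspace.mem_submodule_iff _ (nuVec_ne_zero hu)).1 hW)
  · rintro h _ ⟨Q, rfl⟩ hW
    induction Q using Projectivization.ind with
    | h u hu =>
    exact h u hu ((Projectivization.Subspace.mem_submodule_iff _ (nuVec_ne_zero hu)).2 hW)

lemma inter_nucleusPlane_iff {W : Subspace5 F} {p : Fin 6 → F} (hp : p ≠ 0) :
    (W : Set (PG5 F)) ∩ nucleusPlane F = {Projectivization.mk F p hp} ↔
      p ∈ Projectivization.Subspace.submodule W ∧ IsNuclear p ∧
      ∀ v ∈ Projectivization.Subspace.submodule W, IsNuclear v → ∃ t : F, v = t • p := by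
  constructor
  · intro h
    have hp' : Projectivization.mk F p hp ∈ (W : Set (PG5 F)) ∩ nucleusPlane F := h.ge rfl
    refine ⟨(Projectivization.Subspace.mem_submodule_iff _ hp).2 hp'.1,
      (mk_mem_nucleusPlane hp).1 hp'.2, fun v hv hN => ?_⟩
    rcases eq_or_ne v 0 with rfl | hv0
    · exact ⟨0, by simp⟩
    · have : Projectivization.mk F v hv0 ∈ ({Projectivization.mk F p hp} : Set (PG5 F)) :=
        h.le ⟨(Projectivization.Subspace.mem_submodule_iff _ hv0).1 hv,
          (mk_mem_nucleusPlane hv0).2 hN⟩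
      obtain ⟨t, ht⟩ := (Projectivization.mk_eq_mk_iff' F _ _ _ _).1 this
      exact ⟨t, ht.symm⟩
  · rintro ⟨hpW, hN, h⟩
    refine Set.Subset.antisymm ?_ ?_
    · rintro Q ⟨hQ, hQN⟩
      induction Q using Projectivization.ind with
      | h v hv =>
      obtain ⟨t, ht⟩ := h v ((Projectivization.Subspace.mem_submodule_iff _ hv).2 hQ)
        ((mk_mem_nucleusPlane hv).1 hQN)
      exact (Projectivization.mk_eq_mk_iff' F _ _ _ _).2 ⟨t, ht.symm⟩
    · rintro _ rfl
      exact ⟨(Projectivization.Subspace.mem_submodule_iff _ hp).1 hpW,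
        (mk_mem_nucleusPlane hp).2 hN⟩

/-- Both hyperplanes come from vectors, unique up to a scalar. The vector of `H(P)` spans the kernel
of `symMat p`, so the hyperplanes agree exactly when the vector `c` of `H(π)` satisfies `symMat p *ᵥ
c = 0`. -/
lemma differentHyperplanes_iff [Finite F] [CharP F 2] (W : Subspace5 F) :
    DifferentHyperplanes W ↔
      HasDifferentHyperplanes (Projectivization.Subspace.submodule W) := by
  constructor
  · rintro ⟨hW, hd, P, hP, hne⟩
    induction P using Projectivization.ind with
    | h p hp =>
    obtain ⟨hpW, hN, hspan⟩ := (inter_nucleusPlane_iff hp).1 hP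
    obtain ⟨⟨⟨d, hd0, hd⟩, C, hC, hPC, hCH⟩, -⟩ :=
      (existsUnique_hyperplaneOfPoint (mem_nucleusPlane_of_inter_eq hP)).choose_spec
    obtain ⟨⟨⟨c, hc0, hc⟩, hWc⟩, -⟩ := (existsUnique_hyperplaneOfPlane hW hP).choose_spec
    refine ⟨hW, disjoint_surface_iff.1 ‹_›, p, hpW, hp, hN, hspan, c,
      le_delta_iff.1 (hc ▸ hWc), fun h0 => hne ?_⟩
    rw [hyperplaneOfPoint, hyperplaneOfPlane, hd, hc]
    rw [hd] at hCH
    obtain ⟨s, rfl⟩ := exists_eq_smul_kernelVec hp hN h0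
    obtain ⟨t, rfl⟩ := exists_eq_smul_kernelVec hp hN
      (symMat_mulVec_eq_zero_of_conic hp hC hPC hCH)
    rw [delta_squareForm_smul (left_ne_zero_of_smul hd0),
      delta_squareForm_smul (left_ne_zero_of_smul hc0)]
  · rintro ⟨hW, hd, p, hpW, hp, hN, hspan, c, hWc, hne⟩
    have hP := (inter_nucleusPlane_iff hp).2 ⟨hpW, hN, hspan⟩
    refine ⟨hW, disjoint_surface_iff.2 hd, _, hP, fun h => hne ?_⟩
    obtain ⟨⟨-, C, hC, hPC, hCH⟩, -⟩ :=
      (existsUnique_hyperplaneOfPoint (mem_nucleusPlane_of_inter_eq hP)).choose_spec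
    have huniq := (existsUnique_hyperplaneOfPlane hW hP).choose_spec.2
      (delta (squareForm c)) ⟨⟨c, by rintro rfl; simp at hne, rfl⟩, le_delta_iff.2 hWc⟩
    refine symMat_mulVec_eq_zero_of_conic hp hC hPC ?_
    rw [huniq]
    exact hCH.trans h.le

/-! ### Invariance under `K`. -/

/-- Mixed terms appear twice, so the diagonal transforms by itself, through the squared entries of
`A`. This makes the nucleus plane invariant. -/
lemma congrLin_diag [CharP F 2] (A : Matrix (Fin 3) (Fin 3) F) (v : Fin 6 → F) :
    congrLin A v 0 = A 0 0 ^ 2 * v 0 + A 0 1 ^ 2 * v 3 + A 0 2 ^ 2 * v 5 ∧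
    congrLin A v 3 = A 1 0 ^ 2 * v 0 + A 1 1 ^ 2 * v 3 + A 1 2 ^ 2 * v 5 ∧
    congrLin A v 5 = A 2 0 ^ 2 * v 0 + A 2 1 ^ 2 * v 3 + A 2 2 ^ 2 * v 5 := by
  have h2 : (2 : F) = 0 := CharTwo.two_eq_zero
  refine ⟨?_, ?_, ?_⟩ <;>
    simp [congrLin, symCoord, symMat, Matrix.mul_apply, Fin.sum_univ_succ]
  · linear_combination (A 0 0 * A 0 1 * v 1 + A 0 0 * A 0 2 * v 2 + A 0 1 * A 0 2 * v 4) * h2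
  · linear_combination (A 1 0 * A 1 1 * v 1 + A 1 0 * A 1 2 * v 2 + A 1 1 * A 1 2 * v 4) * h2
  · linear_combination (A 2 0 * A 2 1 * v 1 + A 2 0 * A 2 2 * v 2 + A 2 1 * A 2 2 * v 4) * h2

lemma IsNuclear.map [CharP F 2] {v : Fin 6 → F} (hv : IsNuclear v)
    (A : Matrix (Fin 3) (Fin 3) F) : IsNuclear (congrLin A v) := by
  obtain ⟨h0, h3, h5⟩ := hv
  obtain ⟨e0, e3, e5⟩ := congrLin_diag A v
  refine ⟨?_, ?_, ?_⟩ <;> simp [e0, e3, e5, h0, h3, h5]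

lemma isNuclear_congrLin_iff [CharP F 2] (A : GL (Fin 3) F) {v : Fin 6 → F} :
    IsNuclear (congrLin (A : Matrix (Fin 3) (Fin 3) F) v) ↔ IsNuclear v := by
  refine ⟨fun h => ?_, fun h => h.map _⟩
  have := IsNuclear.map h ((A⁻¹ : GL (Fin 3) F) : Matrix (Fin 3) (Fin 3) F)
  rwa [congrLin_inv_apply] at this

lemma GL_mulVec_ne_zero (A : GL (Fin 3) F) {u : Fin 3 → F} (hu : u ≠ 0) :
    (A : Matrix (Fin 3) (Fin 3) F) *ᵥ u ≠ 0 := by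
  intro h
  apply hu
  have := congrArg (((A⁻¹ : GL (Fin 3) F) : Matrix (Fin 3) (Fin 3) F) *ᵥ ·) h
  simpa [Matrix.mulVec_mulVec, ← Units.val_mul] using this

/-- Points move by `M ↦ A M Aᵀ`, so the vector `c` of the hyperplane moves by the inverse transpose
of `A`. -/
lemma HasDifferentHyperplanes.map [CharP F 2] {U : Submodule F (Fin 6 → F)}
    (h : HasDifferentHyperplanes U) (A : GL (Fin 3) F) :
    HasDifferentHyperplanes (congrMap A U) := by
  obtain ⟨hU, hd, p, hpU, hp, hN, hspan, c, hc, hne⟩ := h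
  have hcancel : (A : Matrix (Fin 3) (Fin 3) F)ᵀ *ᵥ
      (((A⁻¹ : GL (Fin 3) F) : Matrix (Fin 3) (Fin 3) F)ᵀ *ᵥ c) = c := by
    rw [Matrix.mulVec_mulVec, ← Matrix.transpose_mul, ← Units.val_mul, inv_mul_cancel,
      Units.val_one, Matrix.transpose_one, Matrix.one_mulVec]
  refine ⟨by rw [finrank_congrMap, hU], ?_, congrLin (A : Matrix (Fin 3) (Fin 3) F) p, (congrLin_mem_congrMap A).2 hpU,
    (map_ne_zero_iff _ (congrLin_injective A)).2 hp, hN.map _, ?_,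
    ((A⁻¹ : GL (Fin 3) F) : Matrix (Fin 3) (Fin 3) F)ᵀ *ᵥ c, ?_, ?_⟩
  · rintro u hu ⟨w, hw, hwu⟩
    have := congrArg (congrLin ((A⁻¹ : GL (Fin 3) F) : Matrix (Fin 3) (Fin 3) F)) hwu
    rw [congrLin_inv_apply, congrLin_nuVec] at this
    exact hd _ (GL_mulVec_ne_zero A⁻¹ hu) (this ▸ hw)
  · rintro _ ⟨v, hv, rfl⟩ hvN
    obtain ⟨t, rfl⟩ := hspan v hv ((isNuclear_congrLin_iff A).1 hvN)
    exact ⟨t, map_smul _ _ _⟩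
  · rintro _ ⟨v, hv, rfl⟩
    rw [symMat_congrLin, ← Matrix.mulVec_mulVec, hcancel, ← Matrix.mulVec_mulVec,
      Matrix.dotProduct_mulVec, ← Matrix.mulVec_transpose, hcancel]
    exact hc v hv
  · rw [symMat_congrLin, ← Matrix.mulVec_mulVec, hcancel, ← Matrix.mulVec_mulVec]
    exact GL_mulVec_ne_zero A hne

/-! ### The normal form and its residual transformations. -/

/-- The planes of `PG(5,q)` in normal form. -/
def normalPlane (b c d e : F) : Submodule F (Fin 6 → F) where
  carrier := {v | v 1 = b * v 0 + c * v 3 ∧ v 2 = d * v 0 + e * v 3 ∧ v 5 = 0}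
  add_mem' := by
    rintro v w ⟨h1, h2, h3⟩ ⟨k1, k2, k3⟩
    refine ⟨?_, ?_, ?_⟩ <;> simp only [Pi.add_apply, h1, h2, h3, k1, k2, k3] <;> ring
  zero_mem' := by simp
  smul_mem' := by
    rintro t v ⟨h1, h2, h3⟩
    refine ⟨?_, ?_, ?_⟩ <;> simp only [Pi.smul_apply, smul_eq_mul, h1, h2, h3] <;> ring

lemma mem_normalPlane {b c d e : F} {v : Fin 6 → F} :
    v ∈ normalPlane b c d e ↔ v 1 = b * v 0 + c * v 3 ∧ v 2 = d * v 0 + e * v 3 ∧ v 5 = 0 :=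
  Iff.rfl

/-- The coordinates `Y₀`, `Y₃`, `Y₄`. -/
def coords034 : (Fin 6 → F) →ₗ[F] (Fin 3 → F) where
  toFun v := ![v 0, v 3, v 4]
  map_add' v w := by ext i; fin_cases i <;> rfl
  map_smul' t v := by ext i; fin_cases i <;> rfl

lemma finrank_normalPlane (b c d e : F) : Module.finrank F (normalPlane b c d e) = 3 := by
  have hinj : Function.Injective (coords034.domRestrict (normalPlane b c d e)) := by
    rintro ⟨v, h1, h2, h3⟩ ⟨w, k1, k2, k3⟩ h
    have e0 : v 0 = w 0 := congrFun h 0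
    have e3 : v 3 = w 3 := congrFun h 1
    have e4 : v 4 = w 4 := congrFun h 2
    ext i
    fin_cases i <;> simp [h1, h2, h3, k1, k2, k3, e0, e3, e4]
  have hsurj : Function.Surjective (coords034.domRestrict (normalPlane b c d e)) := by
    intro w
    refine ⟨⟨![w 0, b * w 0 + c * w 1, d * w 0 + e * w 1, w 1, w 2, 0], rfl, rfl, rfl⟩, ?_⟩
    ext i; fin_cases i <;> rfl
  rw [(LinearEquiv.ofBijective _ ⟨hinj, hsurj⟩).finrank_eq, Module.finrank_fin_fun]

/-- The hypotheses make `Y₀, Y₃, Y₄` coordinates on `U`. The parameters are read off from the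
vectors with coordinates `(1, 0, 0)` and `(0, 1, 0)`; by `hN`, `Y₄` does not contribute to `Y₁` and
`Y₂`. -/
lemma exists_eq_normalPlane {U : Submodule F (Fin 6 → F)} (hU : Module.finrank F U = 3)
    (h5 : ∀ v ∈ U, v 5 = 0) (hN : ∀ v ∈ U, v 0 = 0 → v 3 = 0 → v 1 = 0 ∧ v 2 = 0) :
    ∃ b c d e : F, U = normalPlane b c d e := by
  have hinj : Function.Injective (coords034.domRestrict U) := by
    rw [← LinearMap.ker_eq_bot, LinearMap.ker_eq_bot']
    rintro ⟨v, hv⟩ h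
    have e0 : v 0 = 0 := congrFun h 0
    have e3 : v 3 = 0 := congrFun h 1
    have e4 : v 4 = 0 := congrFun h 2
    obtain ⟨e1, e2⟩ := hN v hv e0 e3
    ext i
    fin_cases i <;> simp [e0, e1, e2, e3, e4, h5 v hv]
  have hsurj := (LinearMap.injective_iff_surjective_of_finrank_eq_finrank
    (by rw [hU, Module.finrank_fin_fun])).1 hinj
  obtain ⟨⟨v, hv⟩, hv'⟩ := hsurj ![1, 0, 0]
  obtain ⟨⟨w, hw⟩, hw'⟩ := hsurj ![0, 1, 0]
  have v0 : v 0 = 1 := congrFun hv' 0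
  have v3 : v 3 = 0 := congrFun hv' 1
  have w0 : w 0 = 0 := congrFun hw' 0
  have w3 : w 3 = 1 := congrFun hw' 1
  refine ⟨v 1, w 1, v 2, w 2, Submodule.eq_of_le_of_finrank_eq ?_ ?_⟩
  · intro u hu
    obtain ⟨e1, e2⟩ := hN (u - u 0 • v - u 3 • w)
      (U.sub_mem (U.sub_mem hu (U.smul_mem _ hv)) (U.smul_mem _ hw))
      (by simp [v0, w0]) (by simp [v3, w3])
    simp only [Pi.sub_apply, Pi.smul_apply, smul_eq_mul] at e1 e2
    exact ⟨by linear_combination e1, by linear_combination e2, h5 u hu⟩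
  · rw [hU, finrank_normalPlane]

lemma HasDifferentHyperplanes.exists_congrMap_eq_normalPlane [CharP F 2]
    {U : Submodule F (Fin 6 → F)} (h : HasDifferentHyperplanes U) :
    ∃ (A : GL (Fin 3) F) (b c d e : F), congrMap A U = normalPlane b c d e := by
  have h2 : (2 : F) = 0 := CharTwo.two_eq_zero
  obtain ⟨hU, -, p, -, -, hp, hspan, c, hc, hne⟩ := h
  obtain ⟨i, hi⟩ := Function.ne_iff.1 hne
  obtain ⟨p0, p3, p5⟩ := hp
  obtain ⟨m, hm⟩ : ∃ m : Fin 3 → F, m ⬝ᵥ symMat p *ᵥ c ≠ 0 :=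
    ⟨Pi.single i 1, by simpa [single_dotProduct] using hi⟩
  -- The last row makes `Y₅` of the image equal to `c ⬝ᵥ symMat v *ᵥ c`, which vanishes on `U`. The
  -- first row is the kernel vector of `p`, so the image of `p` has `Y₁ = Y₂ = 0`. The row `m` makes
  -- `B` invertible, since the determinant is `m ⬝ᵥ symMat p *ᵥ c`.
  set B : Matrix (Fin 3) (Fin 3) F := !![p 4, p 2, p 1; m 0, m 1, m 2; c 0, c 1, c 2] with hB
  have hdet : B.det = m ⬝ᵥ symMat p *ᵥ c := by
    rw [hB, Matrix.det_fin_three]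
    simp [symMat, Matrix.mulVec, dotProduct, Fin.sum_univ_succ, p0, p3, p5]
    linear_combination
      (- (p 4 * m 2 * c 1) - p 2 * m 0 * c 2 - p 1 * m 1 * c 0) * h2
  refine ⟨Matrix.GeneralLinearGroup.mkOfDetNeZero B (hdet ▸ hm),
    exists_eq_normalPlane (by rw [finrank_congrMap, hU]) ?_ ?_⟩
  · rintro _ ⟨v, hv, rfl⟩
    have := hc v hv
    rw [← squareForm_dotProduct_eq, squareForm_dotProduct] at this
    change congrLin B v 5 = 0
    rw [(congrLin_diag B v).2.2]
    exact this
  · rintro _ ⟨v, hv, rfl⟩ e0 e3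
    have e5 : congrLin B v 5 = 0 := by
      have := hc v hv
      rw [← squareForm_dotProduct_eq, squareForm_dotProduct] at this
      rw [(congrLin_diag B v).2.2]
      exact this
    obtain ⟨t, rfl⟩ := hspan v hv ((isNuclear_congrLin_iff
      (Matrix.GeneralLinearGroup.mkOfDetNeZero B (hdet ▸ hm))).1 ⟨e0, e3, e5⟩)
    rw [map_smul]
    change t * congrLin B p 1 = 0 ∧ t * congrLin B p 2 = 0
    constructor <;> convert mul_zero t <;>
      simp [congrLin, symCoord, symMat, hB, Matrix.mul_apply, Fin.sum_univ_succ, p0, p3, p5]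
    · linear_combination (p 4 * p 2 * m 2 + p 4 * p 1 * m 1 + p 2 * p 1 * m 0) * h2
    · linear_combination (p 4 * p 2 * c 2 + p 4 * p 1 * c 1 + p 2 * p 1 * c 0) * h2

lemma hasDifferentHyperplanes_normalPlane_iff {b c d e : F} :
    HasDifferentHyperplanes (normalPlane b c d e) ↔
      ∀ x y : F, x * y = b * x ^ 2 + c * y ^ 2 → d * x ^ 2 + e * y ^ 2 = 0 → x = 0 ∧ y = 0 := by
  constructor
  · rintro ⟨-, hd, -⟩ x y h1 h2
    by_contra hxy
    refine hd ![x, y, 0] (fun h => hxy ⟨congrFun h 0, congrFun h 1⟩) ?_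
    simp [mem_normalPlane, nuVec, h1, h2]
  · intro h
    -- In normal form `P` is the unit vector of `Y₄` and `H(π)` is `Y₅ = 0`. The latter forces `u 2
    -- = 0` whenever `nuVec u` is in the plane.
    refine ⟨finrank_normalPlane b c d e, ?_, Pi.single 4 1, ?_, ?_, ?_, ?_, Pi.single 2 1, ?_, ?_⟩
    · rintro u hu ⟨h1, h2, h5⟩
      simp only [nuVec, Matrix.cons_val] at h1 h2 h5
      have u2 : u 2 = 0 := by simpa using h5
      obtain ⟨u0, u1⟩ := h (u 0) (u 1) h1 (by rw [← h2, u2, mul_zero])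
      apply hu
      ext i; fin_cases i <;> simp [u0, u1, u2]
    · simp [mem_normalPlane]
    · simp
    · simp [IsNuclear]
    · rintro v ⟨h1, h2, h5⟩ ⟨h0, h3, -⟩
      refine ⟨v 4, ?_⟩
      ext i; fin_cases i <;> simp [h0, h3, h5, h1, h2]
    · rintro v ⟨-, -, h5⟩
      simp [symMat, h5, Matrix.mulVec, dotProduct, Fin.sum_univ_succ]
    · intro h
      have := congrFun h 1
      simp [symMat, Matrix.mulVec, dotProduct, Fin.sum_univ_succ] at this

/-- The matrices `!![α, 0, 0; r, s, t; 0, 0, γ]` fix the point of `Pi.single 4 1` and the hyperplane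
`Y₅ = 0`. The four equations compare the coefficients of `v 0` and `v 3` in the two defining
relations of the target plane; `t` does not enter the new `Y₃` because `v 5 = 0`. -/
lemma exists_congrMap_normalPlane_eq [CharP F 2] {b c d e b' c' d' e' α r s t γ : F} (hα : α ≠ 0)
    (hs : s ≠ 0) (hγ : γ ≠ 0) (h1 : α * (r + s * b + t * d) = b' * α ^ 2 + c' * r ^ 2)
    (h2 : α * (s * c + t * e) = c' * s ^ 2) (h3 : α * γ * d = d' * α ^ 2 + e' * r ^ 2)
    (h4 : α * γ * e = e' * s ^ 2) :
    ∃ A : GL (Fin 3) F, congrMap A (normalPlane b c d e) = normalPlane b' c' d' e' := by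
  set B : Matrix (Fin 3) (Fin 3) F := !![α, 0, 0; r, s, t; 0, 0, γ] with hB
  have hdet : B.det ≠ 0 := by
    have : B.det = α * s * γ := by rw [hB, Matrix.det_fin_three]; simp
    rw [this]
    exact mul_ne_zero (mul_ne_zero hα hs) hγ
  refine ⟨Matrix.GeneralLinearGroup.mkOfDetNeZero B hdet, Submodule.eq_of_le_of_finrank_eq ?_
    (by rw [finrank_congrMap, finrank_normalPlane, finrank_normalPlane])⟩
  rintro _ ⟨v, ⟨k1, k2, k5⟩, rfl⟩
  obtain ⟨e0, e3, e5⟩ := congrLin_diag B v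
  have e1 : congrLin B v 1 = α * (r * v 0 + s * v 1 + t * v 2) := by
    simp [congrLin, symCoord, symMat, hB, Matrix.mul_apply, Fin.sum_univ_succ]; ring
  have e2 : congrLin B v 2 = α * γ * v 2 := by
    simp [congrLin, symCoord, symMat, hB, Matrix.mul_apply, Fin.sum_univ_succ]; ring
  simp only [hB, Matrix.of_apply, Matrix.cons_val, k5] at e0 e3 e5
  change congrLin B v ∈ _
  rw [mem_normalPlane, e1, e2, e5, hB, e0, e3, k1, k2]
  refine ⟨?_, ?_, by ring⟩
  · linear_combination v 0 * h1 + v 3 * h2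
  · linear_combination v 0 * h3 + v 3 * h4

/-! ### The trace and the Artin–Schreier map. -/

lemma absTrace_add [CharP F 2] (a b : F) : absTrace (a + b) = absTrace a + absTrace b := by
  let := ZMod.algebra F 2
  exact map_add (Algebra.trace (ZMod 2) F) a b

/-- The Artin–Schreier map `w ↦ w² + w`. -/
def artinSchreier [CharP F 2] : F →+ F where
  toFun w := w ^ 2 + w
  map_zero' := by ring
  map_add' v w := by
    have h2 : (2 : F) = 0 := CharTwo.two_eq_zero
    linear_combination v * w * h2

/-- The trace is invariant under the Frobenius automorphism. -/
lemma absTrace_sq_add_self [Fintype F] [CharP F 2] (w : F) : absTrace (w ^ 2 + w) = 0 := by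
  let := ZMod.algebra F 2
  have : Fact (Nat.Prime 2) := ⟨Nat.prime_two⟩
  have h := Algebra.trace_eq_of_algEquiv (FiniteField.frobeniusAlgEquivOfAlgebraic (ZMod 2) F) w
  rw [FiniteField.coe_frobeniusAlgEquivOfAlgebraic, ZMod.card] at h
  rw [absTrace_add]
  change Algebra.trace (ZMod 2) F (w ^ 2) + Algebra.trace (ZMod 2) F w = 0
  rw [h]
  exact CharTwo.add_self_eq_zero _

lemma exists_absTrace_eq_one (F : Type*) [Field F] [Fintype F] [CharP F 2] :
    ∃ a : F, absTrace a = 1 := by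
  let := ZMod.algebra F 2
  have : Fact (Nat.Prime 2) := ⟨Nat.prime_two⟩
  exact Algebra.trace_surjective (ZMod 2) F 1

/-- The image of `w ↦ w² + w` lies in the kernel of the trace, which has `q/2` elements. The kernel
of the map is contained in `{0, 1}`, so the image has at least `q/2` elements and the two subgroups
agree. -/
lemma exists_eq_sq_add_self [Fintype F] [CharP F 2] {a : F} (ha : absTrace a = 0) :
    ∃ w : F, w ^ 2 + w = a := by
  let := ZMod.algebra F 2
  have : Fact (Nat.Prime 2) := ⟨Nat.prime_two⟩
  let T : F →+ ZMod 2 := (Algebra.trace (ZMod 2) F).toAddMonoidHom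
  have hle : (artinSchreier (F := F)).range ≤ T.ker := by
    rintro _ ⟨w, rfl⟩
    exact absTrace_sq_add_self w
  have hT : Nat.card T.ker * 2 = Nat.card F := by
    rw [← T.ker.card_mul_index, AddSubgroup.index_ker,
      AddMonoidHom.range_eq_top.2 (Algebra.trace_surjective (ZMod 2) F), AddSubgroup.card_top,
      Nat.card_zmod]
  have hker : Nat.card (artinSchreier (F := F)).ker ≤ 2 := by
    have : ((artinSchreier (F := F)).ker : Set F) ⊆ {0, 1} := by
      intro w hw
      have h : w * (w + 1) = 0 := by
        have : w ^ 2 + w = 0 := hw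
        linear_combination this
      rcases mul_eq_zero.1 h with h | h
      · exact Or.inl h
      · exact Or.inr (by rw [← CharTwo.neg_eq (1 : F)]; exact eq_neg_of_add_eq_zero_left h)
    calc Nat.card (artinSchreier (F := F)).ker ≤ Set.ncard ({0, 1} : Set F) :=
          Set.ncard_le_ncard this (Set.toFinite _)
      _ ≤ 2 := Set.ncard_insert_le _ _ |>.trans (by simp)
  have hA : Nat.card (artinSchreier (F := F)).ker * Nat.card (artinSchreier (F := F)).range
      = Nat.card F := by
    rw [← AddSubgroup.index_ker, AddSubgroup.card_mul_index]
  have heq : (artinSchreier (F := F)).range = T.ker := by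
    apply AddSubgroup.eq_of_le_of_card_ge hle
    nlinarith
  have : a ∈ (artinSchreier (F := F)).range := heq ▸ (show a ∈ T.ker from ha)
  exact this

lemma ne_zero_of_absTrace_eq_one [CharP F 2] {a : F} (ha : absTrace a = 1) : a ≠ 0 := by
  rintro rfl
  have h := absTrace_add (0 : F) 0
  rw [add_zero, ha] at h
  exact absurd h (by decide)

/-! ### The representatives in normal form. -/

lemma rep21_eq (a : F) : rep21 a = pointSet (normalPlane 1 a 0 0) := by
  ext P
  rw [mem_pointSet_iff_rep, mem_normalPlane]
  constructor
  · rintro ⟨x, y, z, h⟩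
    have := congrArg symCoord h
    rw [symCoord_symMat] at this
    simp [this, symCoord]
  · rintro ⟨h1, h2, h5⟩
    refine ⟨P.rep 0, P.rep 4, P.rep 3, ?_⟩
    simp [symMat, h1, h2, h5]

lemma rep22_eq : rep22 F = pointSet (normalPlane 1 1 0 1) := by
  ext P
  rw [mem_pointSet_iff_rep, mem_normalPlane]
  constructor
  · rintro ⟨x, y, z, h⟩
    have := congrArg symCoord h
    rw [symCoord_symMat] at this
    simp [this, symCoord]
  · rintro ⟨h1, h2, h5⟩
    refine ⟨P.rep 0, P.rep 4, P.rep 3, ?_⟩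
    simp [symMat, h1, h2, h5]

lemma rep23_eq (a : F) : rep23 a = pointSet (normalPlane 0 a 1 0) := by
  ext P
  rw [mem_pointSet_iff_rep, mem_normalPlane]
  constructor
  · rintro ⟨x, y, z, h⟩
    have := congrArg symCoord h
    rw [symCoord_symMat] at this
    simp [this, symCoord]
  · rintro ⟨h1, h2, h5⟩
    refine ⟨P.rep 0, P.rep 4, P.rep 3, ?_⟩
    simp [symMat, h1, h2, h5]

lemma hasDifferentHyperplanes_21 [Fintype F] [CharP F 2] {a : F} (ha : absTrace a = 1) :
    HasDifferentHyperplanes (normalPlane 1 a 0 0) := by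
  rw [hasDifferentHyperplanes_normalPlane_iff]
  intro x y h _
  have h2 : (2 : F) = 0 := CharTwo.two_eq_zero
  have hy : y = 0 := by
    by_contra hy
    -- For `y ≠ 0` the equation reads `(x/y)² + x/y = a`, which would give `a` trace 0. Both sides
    -- are shifted by `a² + a`, itself of trace 0.
    have : (a + x / y) ^ 2 + (a + x / y) = a ^ 2 + a + a := by
      field_simp
      linear_combination -h + (a * x * y + x * y - a * y ^ 2) * h2
    have h0 := absTrace_sq_add_self (a + x / y)
    rw [this, absTrace_add, absTrace_sq_add_self, zero_add, ha] at h0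
    exact one_ne_zero h0
  subst hy
  simpa using h.symm

lemma hasDifferentHyperplanes_22 : HasDifferentHyperplanes (normalPlane (1 : F) 1 0 1) := by
  rw [hasDifferentHyperplanes_normalPlane_iff]
  intro x y h h'
  obtain rfl : y = 0 := by simpa using h'
  simpa using h.symm

lemma hasDifferentHyperplanes_23 {a : F} (ha : a ≠ 0) :
    HasDifferentHyperplanes (normalPlane 0 a 1 0) := by
  rw [hasDifferentHyperplanes_normalPlane_iff]
  intro x y h h'
  obtain rfl : x = 0 := by simpa using h'
  simpa [ha] using h.symm

/-! ### Reduction of the normal forms to the representatives. -/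

lemma HasDifferentHyperplanes.exists_normalPlane_22 [Fintype F] [CharP F 2] {b c d e : F}
    (h : HasDifferentHyperplanes (normalPlane b c d e)) (he : e ≠ 0) :
    ∃ A : GL (Fin 3) F, congrMap A (normalPlane b c d e) = normalPlane 1 1 0 1 := by
  have : Fact (Nat.Prime 2) := ⟨Nat.prime_two⟩
  obtain ⟨r, hr⟩ := surjective_frobenius F 2 (d / e)
  rw [frobenius_def] at hr
  obtain ⟨A, hA⟩ : ∃ A : GL (Fin 3) F, congrMap A (normalPlane b c d e) =
      normalPlane (r + b - c / e * d) 0 0 1 := by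
    -- Here `r² = d/e` removes `d`, the choice of `t` removes `c`, and `γ` scales `e` to 1. Only the
    -- first parameter survives.
    refine exists_congrMap_normalPlane_eq (α := 1) (s := 1) (γ := 1 / e) (r := r) (t := -(c / e))
      one_ne_zero one_ne_zero (by simp [he]) (by ring) ?_ ?_ ?_
    · field_simp; ring
    · rw [hr]; field_simp; ring
    · field_simp
  set f := r + b - c / e * d
  -- If `f = 0`, the plane contains `ν(1, 0, 0)`.
  have hf : f ≠ 0 := by
    intro hf
    have := hasDifferentHyperplanes_normalPlane_iff.1 (hA ▸ h.map A) 1 0 (by simp [hf]) (by simp)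
    exact one_ne_zero this.1
  obtain ⟨B, hB⟩ : ∃ B : GL (Fin 3) F, congrMap B (normalPlane f 0 0 1) = normalPlane 1 1 0 1 := by
    refine exists_congrMap_normalPlane_eq (α := f) (s := 1) (γ := 1 / f) (r := 0) (t := 1 / f)
      hf one_ne_zero (by simp [hf]) ?_ ?_ ?_ ?_ <;> field_simp <;> ring
  exact ⟨B * A, by rw [congrMap_mul, hA, hB]⟩

/-- Disjointness forces `c ≠ 0`, as otherwise `ν(0, 1, 0)` is in the plane. Then `γ` scales `d` to
1, `s` turns `c` into `a`, and `t` cancels `b`. No trace condition arises. -/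
lemma HasDifferentHyperplanes.exists_normalPlane_23 [CharP F 2] {b c d a : F}
    (h : HasDifferentHyperplanes (normalPlane b c d 0)) (hd : d ≠ 0) (ha : a ≠ 0) :
    ∃ A : GL (Fin 3) F, congrMap A (normalPlane b c d 0) = normalPlane 0 a 1 0 := by
  have hc : c ≠ 0 := by
    rintro rfl
    exact one_ne_zero
      (hasDifferentHyperplanes_normalPlane_iff.1 h 0 1 (by simp) (by simp)).2
  refine exists_congrMap_normalPlane_eq (α := 1) (s := c / a) (γ := 1 / d) (r := 0)
    (t := -(c / a * b / d)) one_ne_zero (by simp [hc, ha]) (by simp [hd]) ?_ ?_ ?_ ?_ <;>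
    field_simp <;> ring

lemma HasDifferentHyperplanes.exists_normalPlane_21 [Fintype F] [CharP F 2] {b c a : F}
    (h : HasDifferentHyperplanes (normalPlane b c 0 0)) (ha : absTrace a = 1) :
    ∃ A : GL (Fin 3) F, congrMap A (normalPlane b c 0 0) = normalPlane 1 a 0 0 := by
  have h2 : (2 : F) = 0 := CharTwo.two_eq_zero
  have ha0 := ne_zero_of_absTrace_eq_one ha
  have h' := hasDifferentHyperplanes_normalPlane_iff.1 h
  have hb : b ≠ 0 := by
    rintro rfl
    exact one_ne_zero (h' 1 0 (by simp) (by simp)).1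
  have hc : c ≠ 0 := by
    rintro rfl
    exact one_ne_zero (h' 0 1 (by simp) (by simp)).2
  -- If `w² + w = bc`, then `(x, y) = (w/b, 1)` solves `xy = bx² + cy²`, so the plane meets the
  -- surface.
  have htr : absTrace (b * c) ≠ 0 := by
    intro h0
    obtain ⟨w, hw⟩ := exists_eq_sq_add_self h0
    refine one_ne_zero (h' (w / b) 1 ?_ (by simp)).2
    field_simp
    linear_combination -hw + (w - b * c) * h2
  -- Both traces are 1, so the sum has trace 0. With `s = c/a` and `r = w/a`, the remaining equation
  -- `r + sb = 1 + ar²` becomes `w² + w = a + bc`.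
  obtain ⟨w, hw⟩ := exists_eq_sq_add_self (a := a + b * c) (by
    rw [absTrace_add, ha]
    revert htr
    generalize absTrace (b * c) = k
    revert k
    decide)
  refine exists_congrMap_normalPlane_eq (α := 1) (s := c / a) (γ := 1) (r := w / a)
    (t := 0) one_ne_zero (by simp [hc, ha0]) one_ne_zero ?_ ?_ (by simp) (by simp)
  · field_simp
    linear_combination -hw + (w - a) * h2
  · field_simp
    ring

/-! ### Ranks and the invariance of the point-orbit distribution. -/

lemma pointRank_mk {v : Fin 6 → F} (hv : v ≠ 0) :
    pointRank (Projectivization.mk F v hv) = (symMat v).rank := by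
  obtain ⟨t, ht⟩ := Projectivization.exists_smul_eq_mk_rep F v hv
  rw [pointRank, ← ht, Units.smul_def, symMat_smul,
    Matrix.rank_smul_of_mem_nonZeroDivisors _ (mem_nonZeroDivisors_of_ne_zero t.ne_zero)]

lemma rank_symMat_congrLin (A : GL (Fin 3) F) (v : Fin 6 → F) :
    (symMat (congrLin (A : Matrix (Fin 3) (Fin 3) F) v)).rank = (symMat v).rank := by
  have hA : IsUnit (A : Matrix (Fin 3) (Fin 3) F).det := (Matrix.isUnit_iff_isUnit_det _).1 A.isUnit
  rw [symMat_congrLin, Matrix.rank_mul_eq_left_of_isUnit_det _ _ (by rwa [Matrix.det_transpose]),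
    Matrix.rank_mul_eq_right_of_isUnit_det _ _ hA]

lemma alpha_smul_mk (A : GL (Fin 3) F) {v : Fin 6 → F} (hv : v ≠ 0) :
    alpha (Matrix.ProjGenLinGroup.mk A) • Projectivization.mk F v hv =
      Projectivization.mk F (congrLin (A : Matrix (Fin 3) (Fin 3) F) v)
        ((map_ne_zero_iff _ (congrLin_injective A)).2 hv) :=
  (alpha_mk_smul_mk A hv).2

lemma pointRank_alpha_smul (A : GL (Fin 3) F) (P : PG5 F) :
    pointRank (alpha (Matrix.ProjGenLinGroup.mk A) • P) = pointRank P := by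
  induction P using Projectivization.ind with
  | h v hv => rw [alpha_smul_mk, pointRank_mk, pointRank_mk, rank_symMat_congrLin]

lemma alpha_smul_mem_nucleusPlane_iff [CharP F 2] (A : GL (Fin 3) F) (P : PG5 F) :
    alpha (Matrix.ProjGenLinGroup.mk A) • P ∈ nucleusPlane F ↔ P ∈ nucleusPlane F := by
  induction P using Projectivization.ind with
  | h v hv =>
    rw [alpha_smul_mk, mk_mem_nucleusPlane, mk_mem_nucleusPlane, isNuclear_congrLin_iff]

lemma ncard_sep_smul {G α : Type*} [Group G] [MulAction G α] (g : G) (S : Set α) {Q : α → Prop}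
    (hQ : ∀ P, Q (g • P) ↔ Q P) : {P ∈ g • S | Q P}.ncard = {P ∈ S | Q P}.ncard := by
  have : {P ∈ g • S | Q P} = (g • ·) '' {P ∈ S | Q P} := by
    ext P
    constructor
    · rintro ⟨⟨R, hR, rfl⟩, h⟩
      exact ⟨R, ⟨hR, (hQ R).1 h⟩, rfl⟩
    · rintro ⟨R, ⟨hR, h⟩, rfl⟩
      exact ⟨⟨R, hR, rfl⟩, (hQ R).2 h⟩
  rw [this, Set.ncard_image_of_injective _ (MulAction.injective g)]

lemma OD0_alpha_smul [CharP F 2] (A : GL (Fin 3) F) (S : Set (PG5 F)) :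
    OD0 (alpha (Matrix.ProjGenLinGroup.mk A) • S) = OD0 S := by
  rw [OD0, OD0, ncard_sep_smul (Q := fun P => pointRank P = 1),
    ncard_sep_smul (Q := fun P => pointRank P = 2 ∧ P ∈ nucleusPlane F),
    ncard_sep_smul (Q := fun P => pointRank P = 2 ∧ P ∉ nucleusPlane F),
    ncard_sep_smul (Q := fun P => pointRank P = 3)] <;> intro P <;>
    simp only [pointRank_alpha_smul, alpha_smul_mem_nucleusPlane_iff]

lemma OD0_eq_of_mem_orbitK [CharP F 2] {S T : Set (PG5 F)} (h : S ∈ orbitK T) : OD0 S = OD0 T := by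
  obtain ⟨A, rfl⟩ := mem_orbitK_iff.1 h
  exact OD0_alpha_smul A T

lemma two_le_rank_symMat {v : Fin 6 → F}
    (h : v 0 * v 3 ≠ v 1 ^ 2 ∨ v 0 * v 5 ≠ v 2 ^ 2 ∨ v 3 * v 5 ≠ v 4 ^ 2) :
    2 ≤ (symMat v).rank := by
  have key (i j : Fin 3) (hij : symMat v i i * symMat v j j ≠ symMat v i j * symMat v j i) :
      2 ≤ (symMat v).rank := by
    have hdet : ((symMat v).submatrix ![i, j] ![i, j]).det ≠ 0 := by
      rw [Matrix.det_fin_two]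
      simpa [sub_eq_zero] using hij
    have := Matrix.rank_of_isUnit _ ((Matrix.isUnit_iff_isUnit_det _).2 hdet.isUnit)
    rw [Fintype.card_fin] at this
    exact this.ge.trans (Matrix.rank_submatrix_le _ _ _)
  rcases h with h | h | h
  · exact key 0 1 (by simpa [symMat, sq] using h)
  · exact key 0 2 (by simpa [symMat, sq] using h)
  · exact key 1 2 (by simpa [symMat, sq] using h)

/-- If the principal `2 × 2` minors vanish, then `v 2 = v 4 = 0`. Taking square roots `x`, `y` of `v
0`, `v 3` gives `v 1 = xy`, so `v` would be `ν(x, y, 0)`, a point of the surface unless `v = 0`. -/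
lemma HasDifferentHyperplanes.two_le_rank [Finite F] [CharP F 2] {b c d e : F}
    (h : HasDifferentHyperplanes (normalPlane b c d e)) {v : Fin 6 → F}
    (hv : v ∈ normalPlane b c d e) (hv0 : v ≠ 0) : 2 ≤ (symMat v).rank := by
  have : Fact (Nat.Prime 2) := ⟨Nat.prime_two⟩
  obtain ⟨h1, h2, h5⟩ := hv
  apply two_le_rank_symMat
  by_contra! hcon
  obtain ⟨k1, k2, k4⟩ := hcon
  have v2 : v 2 = 0 := by simpa [h5] using k2.symm
  have v4 : v 4 = 0 := by simpa [h5] using k4.symm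
  obtain ⟨x, hx⟩ := surjective_frobenius F 2 (v 0)
  obtain ⟨y, hy⟩ := surjective_frobenius F 2 (v 3)
  rw [frobenius_def] at hx hy
  have hxy : x * y = v 1 := by
    apply frobenius_inj F 2
    rw [frobenius_def, frobenius_def, mul_pow, hx, hy, k1]
  obtain ⟨rfl, rfl⟩ := hasDifferentHyperplanes_normalPlane_iff.1 h x y
    (by rw [hxy, hx, hy, h1]) (by rw [hx, hy, ← h2, v2])
  apply hv0
  ext i; fin_cases i <;> simp [← hx, ← hy, ← hxy, v2, v4, h5]

lemma rank_symMat_eq_three_iff {v : Fin 6 → F} : (symMat v).rank = 3 ↔ (symMat v).det ≠ 0 := by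
  constructor
  · intro h hdet
    obtain ⟨k, hk, hk0⟩ := Matrix.exists_mulVec_eq_zero_iff.2 hdet
    have h1 := LinearMap.finrank_range_add_finrank_ker (symMat v).mulVecLin
    rw [show Module.finrank F (LinearMap.range (symMat v).mulVecLin) = 3 from h,
      Module.finrank_fin_fun, Nat.add_eq_left, Submodule.finrank_eq_zero] at h1
    have : k ∈ LinearMap.ker (symMat v).mulVecLin := hk0
    rw [h1] at this
    exact hk this
  · intro h
    have := Matrix.rank_of_isUnit _ ((Matrix.isUnit_iff_isUnit_det _).2 h.isUnit)
    rwa [Fintype.card_fin] at this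

lemma det_symMat_of_apply_five_eq_zero [CharP F 2] {v : Fin 6 → F} (h5 : v 5 = 0) :
    (symMat v).det = v 0 * v 4 ^ 2 + v 3 * v 2 ^ 2 := by
  have h2 : (2 : F) = 0 := CharTwo.two_eq_zero
  rw [Matrix.det_fin_three]
  simp [symMat, h5]
  linear_combination (v 1 * v 2 * v 4 - v 0 * v 4 ^ 2 - v 3 * v 2 ^ 2) * h2

/-! ### Counting points by rank. -/

/-- Normalized vectors of the points of a plane in normal form outside the nucleus plane. -/
def chartVec (b c d e : F) : (F × F) ⊕ F → Fin 6 → F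
  | .inl (y, z) => ![1, b + c * z, d + e * z, z, y, 0]
  | .inr y => ![0, c, e, 1, y, 0]

lemma chartVec_not_isNuclear (b c d e : F) (s : (F × F) ⊕ F) :
    ¬ IsNuclear (chartVec b c d e s) := by
  rintro ⟨h0, h3, -⟩
  rcases s with ⟨y, z⟩ | y
  · exact one_ne_zero h0
  · exact one_ne_zero h3

lemma chartVec_ne_zero (b c d e : F) (s : (F × F) ⊕ F) : chartVec b c d e s ≠ 0 :=
  fun h => chartVec_not_isNuclear b c d e s (by simp [h, IsNuclear])

lemma chartVec_mem (b c d e : F) (s : (F × F) ⊕ F) :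
    chartVec b c d e s ∈ normalPlane b c d e := by
  rcases s with ⟨y, z⟩ | y <;> simp [chartVec, mem_normalPlane]

/-- The points of a plane in normal form outside the nucleus plane. -/
def chart (b c d e : F) (s : (F × F) ⊕ F) : PG5 F :=
  Projectivization.mk F _ (chartVec_ne_zero b c d e s)

lemma chart_injective (b c d e : F) : Function.Injective (chart b c d e) := by
  intro s s' h
  obtain ⟨t, ht⟩ := (Projectivization.mk_eq_mk_iff' F _ _ _ _).1 h
  have h0 := congrFun ht 0
  have h3 := congrFun ht 3
  have h4 := congrFun ht 4
  rcases s with ⟨y, z⟩ | y <;> rcases s' with ⟨y', z'⟩ | y' <;>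
    simp [chartVec] at h0 h3 h4 ⊢ <;> simp_all

lemma exists_chart_eq {b c d e : F} {P : PG5 F} (hP : P ∈ pointSet (normalPlane b c d e))
    (hN : P ∉ nucleusPlane F) : ∃ s, chart b c d e s = P := by
  induction P using Projectivization.ind with
  | h v hv =>
  rw [mk_mem_nucleusPlane] at hN
  obtain ⟨h1, h2, h5⟩ := (mk_mem_pointSet hv).1 hP
  by_cases h0 : v 0 = 0
  · have h3 : v 3 ≠ 0 := fun h3 => hN ⟨h0, h3, h5⟩
    refine ⟨.inr (v 4 / v 3), (Projectivization.mk_eq_mk_iff' F _ _ _ _).2 ⟨(v 3)⁻¹, ?_⟩⟩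
    ext i
    fin_cases i <;> simp [chartVec, h0, h1, h2, h5] <;> field_simp
  · refine ⟨.inl (v 4 / v 0, v 3 / v 0),
      (Projectivization.mk_eq_mk_iff' F _ _ _ _).2 ⟨(v 0)⁻¹, ?_⟩⟩
    ext i
    fin_cases i <;> simp [chartVec, h0, h1, h2, h5] <;> field_simp

lemma sep_normalPlane_eq_image_chart (b c d e : F) {Q : PG5 F → Prop}
    {D : Set ((F × F) ⊕ F)} (hN : ∀ P ∈ pointSet (normalPlane b c d e), Q P → P ∉ nucleusPlane F)
    (hD : ∀ s, Q (chart b c d e s) ↔ s ∈ D) :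
    {P ∈ pointSet (normalPlane b c d e) | Q P} = chart b c d e '' D := by
  ext P
  constructor
  · rintro ⟨hP, hQ⟩
    obtain ⟨s, rfl⟩ := exists_chart_eq hP (hN P hP hQ)
    exact ⟨s, (hD s).1 hQ, rfl⟩
  · rintro ⟨s, hs, rfl⟩
    exact ⟨(mk_mem_pointSet _).2 (chartVec_mem b c d e s), (hD s).2 hs⟩

/-- There are no points of rank 1, and `P` is the only nuclear point, of rank 2. The other `q² + q`
points are listed by `chart` and have rank 2 or 3 according to the determinant. -/
lemma HasDifferentHyperplanes.OD0_eq [Fintype F] [CharP F 2] {b c d e : F}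
    (h : HasDifferentHyperplanes (normalPlane b c d e)) :
    OD0 (pointSet (normalPlane b c d e)) =
      ![0, 1, {s | (symMat (chartVec b c d e s)).det = 0}.ncard,
        Fintype.card F ^ 2 + Fintype.card F -
          {s | (symMat (chartVec b c d e s)).det = 0}.ncard] := by
  have hrank (v : Fin 6 → F) (hv : v ∈ normalPlane b c d e) (hv0 : v ≠ 0) :
      (symMat v).rank = 2 ↔ (symMat v).det = 0 := by
    have h2 := h.two_le_rank hv hv0
    have h3 : (symMat v).rank ≤ 3 := (symMat v).rank_le_card_height
    rw [← not_iff_not, ← ne_eq (Matrix.det _), ← rank_symMat_eq_three_iff]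
    omega
  have hnuc (v : Fin 6 → F) (hv : v ∈ normalPlane b c d e) (hN : IsNuclear v) :
      v = v 4 • Pi.single 4 1 := by
    obtain ⟨h0, h3, -⟩ := hN
    obtain ⟨h1, h2, h5⟩ := hv
    ext i; fin_cases i <;> simp [h0, h3, h5, h1, h2]
  have hdet (v : Fin 6 → F) (hv : v ∈ normalPlane b c d e) (hN : IsNuclear v) :
      (symMat v).det = 0 := by
    obtain ⟨h0, h3, h5⟩ := hN
    rw [det_symMat_of_apply_five_eq_zero h5, h0, h3]
    ring
  have hE0 : (Pi.single 4 1 : Fin 6 → F) ≠ 0 := by simp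
  have hE : (Pi.single 4 1 : Fin 6 → F) ∈ normalPlane b c d e := by simp [mem_normalPlane]
  have hEN : IsNuclear (Pi.single 4 1 : Fin 6 → F) := by simp [IsNuclear]
  set D : Set ((F × F) ⊕ F) := {s | (symMat (chartVec b c d e s)).det = 0} with hD
  have r1 : {P ∈ pointSet (normalPlane b c d e) | pointRank P = 1} = ∅ := by
    rw [Set.eq_empty_iff_forall_notMem]
    rintro P ⟨hP, hr⟩
    induction P using Projectivization.ind with
    | h v hv =>
    rw [pointRank_mk] at hr
    have := h.two_le_rank ((mk_mem_pointSet hv).1 hP) hv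
    omega
  have r2n : {P ∈ pointSet (normalPlane b c d e) | pointRank P = 2 ∧ P ∈ nucleusPlane F} =
      {Projectivization.mk F (Pi.single 4 1) hE0} := by
    ext P
    induction P using Projectivization.ind with
    | h v hv =>
    simp only [Set.mem_ofPred_eq, mk_mem_pointSet, pointRank_mk, mk_mem_nucleusPlane,
      Set.mem_singleton_iff, Projectivization.mk_eq_mk_iff']
    constructor
    · rintro ⟨hvU, -, hN⟩
      exact ⟨v 4, (hnuc v hvU hN).symm⟩
    · rintro ⟨t, rfl⟩
      have hN : IsNuclear (t • Pi.single 4 1 : Fin 6 → F) := by simp [IsNuclear]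
      have hm := (normalPlane b c d e).smul_mem t hE
      exact ⟨hm, (hrank _ hm hv).2 (hdet _ hm hN), hN⟩
  have r2s : {P ∈ pointSet (normalPlane b c d e) | pointRank P = 2 ∧ P ∉ nucleusPlane F} =
      chart b c d e '' D := by
    apply sep_normalPlane_eq_image_chart
    · exact fun P _ h => h.2
    · intro s
      rw [chart, pointRank_mk, mk_mem_nucleusPlane,
        hrank _ (chartVec_mem b c d e s) (chartVec_ne_zero b c d e s)]
      exact and_iff_left (chartVec_not_isNuclear b c d e s)
  have r3 : {P ∈ pointSet (normalPlane b c d e) | pointRank P = 3} = chart b c d e '' Dᶜ := by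
    apply sep_normalPlane_eq_image_chart
    · intro P hP hr hN
      induction P using Projectivization.ind with
      | h v hv =>
      rw [pointRank_mk, rank_symMat_eq_three_iff] at hr
      exact hr (hdet v ((mk_mem_pointSet hv).1 hP) ((mk_mem_nucleusPlane hv).1 hN))
    · intro s
      rw [chart, pointRank_mk, rank_symMat_eq_three_iff]
      rfl
  rw [OD0, r1, r2n, r2s, r3, Set.ncard_empty, Set.ncard_singleton,
    Set.ncard_image_of_injective _ (chart_injective b c d e),
    Set.ncard_image_of_injective _ (chart_injective b c d e), Set.ncard_compl]
  simp [sq]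

lemma ncard_range_of_injective {α β : Type*} [Fintype α] {f : α → β} (hf : Function.Injective f) :
    (Set.range f).ncard = Fintype.card α := by
  rw [← Set.image_univ, Set.ncard_image_of_injective _ hf, Set.ncard_univ, Nat.card_eq_fintype_card]

/-- The determinant is `y²` on the first part of the chart and 0 on the second, giving `q + q`
zeros. -/
lemma OD0_21 [Fintype F] [CharP F 2] {a : F} (ha : absTrace a = 1) :
    OD0 (pointSet (normalPlane 1 a 0 0)) =
      ![0, 1, 2 * Fintype.card F, Fintype.card F ^ 2 - Fintype.card F] := by
  have : {s | (symMat (chartVec 1 a 0 0 s)).det = 0} =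
      Set.range (Sum.map (fun z : F => ((0, z) : F × F)) (id : F → F)) := by
    ext s
    rw [Set.mem_ofPred_eq, det_symMat_of_apply_five_eq_zero (chartVec_mem 1 a 0 0 s).2.2]
    rcases s with ⟨y, z⟩ | y <;> simp [chartVec, eq_comm (a := (0 : F))]
  rw [(hasDifferentHyperplanes_21 ha).OD0_eq, this, ncard_range_of_injective
    (Function.Injective.sumMap (fun _ _ h => congrArg Prod.snd h) Function.injective_id),
    Fintype.card_sum, ← two_mul]
  congr 4
  omega

/-- The determinant is `y² + z³` on the first part of the chart, a cuspidal cubic parametrised by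
`(t³, t²)`, and 1 on the second. -/
lemma OD0_22 [Fintype F] [CharP F 2] :
    OD0 (pointSet (normalPlane (1 : F) 1 0 1)) =
      ![0, 1, Fintype.card F, Fintype.card F ^ 2] := by
  have : Fact (Nat.Prime 2) := ⟨Nat.prime_two⟩
  have : {s | (symMat (chartVec (1 : F) 1 0 1 s)).det = 0} =
      Set.range (fun t : F => (Sum.inl (t ^ 3, t ^ 2) : (F × F) ⊕ F)) := by
    ext s
    rw [Set.mem_ofPred_eq, det_symMat_of_apply_five_eq_zero (chartVec_mem 1 1 0 1 s).2.2]
    rcases s with ⟨y, z⟩ | y <;> simp [chartVec]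
    rw [CharTwo.add_eq_zero]
    constructor
    · intro h
      obtain ⟨t, rfl⟩ := surjective_frobenius F 2 z
      rw [frobenius_def] at h ⊢
      refine ⟨t, ?_, rfl⟩
      apply frobenius_inj F 2
      rw [frobenius_def, frobenius_def, h]
      ring
    · rintro ⟨t, rfl, rfl⟩
      ring
  rw [hasDifferentHyperplanes_22.OD0_eq, this, ncard_range_of_injective, Nat.add_sub_cancel]
  intro t t' h
  simp only [Sum.inl.injEq, Prod.mk.injEq] at h
  exact frobenius_inj F 2 h.2

/-- The determinant is `y² + z` on the first part of the chart and 0 on the second. -/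
lemma OD0_23 [Fintype F] [CharP F 2] {a : F} (ha : a ≠ 0) :
    OD0 (pointSet (normalPlane 0 a 1 0)) =
      ![0, 1, 2 * Fintype.card F, Fintype.card F ^ 2 - Fintype.card F] := by
  have : {s | (symMat (chartVec 0 a 1 0 s)).det = 0} =
      Set.range (Sum.map (fun y : F => ((y, y ^ 2) : F × F)) (id : F → F)) := by
    ext s
    rw [Set.mem_ofPred_eq, det_symMat_of_apply_five_eq_zero (chartVec_mem 0 a 1 0 s).2.2]
    rcases s with ⟨y, z⟩ | y <;> simp [chartVec, CharTwo.add_eq_zero]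
  rw [(hasDifferentHyperplanes_23 ha).OD0_eq, this, ncard_range_of_injective
    (Function.Injective.sumMap (fun _ _ h => congrArg Prod.fst h) Function.injective_id),
    Fintype.card_sum, ← two_mul]
  congr 4
  omega

/-! ### Separating `Σ₂₁` from `Σ₂₃`. -/

/-- A single coordinate is injective on the matrices of the plane that annihilate `k`, so these form
a space of dimension at most one: no line of the plane has a common kernel vector. -/
lemma exists_coordinate_of_mulVec_eq_zero {a : F} (ha : a ≠ 0) {k : Fin 3 → F} (hk : k ≠ 0) :
    ∃ i : Fin 6, ∀ v ∈ normalPlane 0 a 1 0, symMat v *ᵥ k = 0 → v i = 0 → v = 0 := by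
  have key (v : Fin 6 → F) (hv : v ∈ normalPlane 0 a 1 0) (hvk : symMat v *ᵥ k = 0) :
      (v 0 * k 0 + a * v 3 * k 1 + v 0 * k 2 = 0 ∧ a * v 3 * k 0 + v 3 * k 1 + v 4 * k 2 = 0 ∧
        v 0 * k 0 + v 4 * k 1 = 0) ∧ (v 0 = 0 → v 3 = 0 → v 4 = 0 → v = 0) := by
    obtain ⟨h1, h2, h5⟩ := hv
    refine ⟨⟨?_, ?_, ?_⟩, fun h0 h3 h4 => ?_⟩
    · have := congrFun hvk 0
      simp [symMat, Matrix.mulVec, dotProduct, Fin.sum_univ_succ, h1, h2] at this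
      linear_combination this
    · have := congrFun hvk 1
      simp [symMat, Matrix.mulVec, dotProduct, Fin.sum_univ_succ, h1] at this
      linear_combination this
    · have := congrFun hvk 2
      simp [symMat, Matrix.mulVec, dotProduct, Fin.sum_univ_succ, h2, h5] at this
      linear_combination this
    · ext i; fin_cases i <;> simp [h0, h3, h4, h5, h1, h2]
  by_cases k1 : k 1 = 0
  · by_cases k0 : k 0 = 0
    · have k2 : k 2 ≠ 0 := by
        intro k2
        apply hk
        ext i; fin_cases i <;> simp [k0, k1, k2]
      refine ⟨3, fun v hv hvk h3 => ?_⟩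
      obtain ⟨⟨e0, e1, e2⟩, h⟩ := key v hv hvk
      simp only [k0, k1, h3] at e0 e1 e2
      exact h (by simpa [k2] using e0) h3 (by simpa [k2] using e1)
    · refine ⟨4, fun v hv hvk h4 => ?_⟩
      obtain ⟨⟨e0, e1, e2⟩, h⟩ := key v hv hvk
      simp only [k1, h4] at e0 e1 e2
      exact h (by simpa [k0] using e2) (by simpa [k0, ha] using e1) h4
  · refine ⟨0, fun v hv hvk h0 => ?_⟩
    obtain ⟨⟨e0, e1, e2⟩, h⟩ := key v hv hvk
    simp only [h0] at e0 e1 e2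
    exact h h0 (by simpa [k1, ha] using e0) (by simpa [k1] using e2)

/-- In the first plane all matrices with `v 4 = 0` annihilate the third unit vector, and they form a
two-dimensional space. Congruence by `A` would carry it to a two-dimensional space annihilating `k`
in the second plane. -/
lemma congrMap_normalPlane_21_ne_23 {a a' : F} (ha : a' ≠ 0) (A : GL (Fin 3) F) :
    congrMap A (normalPlane 1 a 0 0) ≠ normalPlane 0 a' 1 0 := by
  intro h
  set k : Fin 3 → F := ((A⁻¹ : GL (Fin 3) F) : Matrix (Fin 3) (Fin 3) F)ᵀ *ᵥ Pi.single 2 1 with hk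
  have hcancel : (A : Matrix (Fin 3) (Fin 3) F)ᵀ *ᵥ k = Pi.single 2 1 := by
    rw [hk, Matrix.mulVec_mulVec, ← Matrix.transpose_mul, ← Units.val_mul, inv_mul_cancel,
      Units.val_one, Matrix.transpose_one, Matrix.one_mulVec]
  have hk0 : k ≠ 0 := by
    intro hk0
    rw [hk0, Matrix.mulVec_zero] at hcancel
    simpa using congrFun hcancel 2
  obtain ⟨i, hi⟩ := exists_coordinate_of_mulVec_eq_zero ha hk0
  have hi' (v : Fin 6 → F) (hv : v ∈ normalPlane 1 a 0 0) (h4 : v 4 = 0)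
      (hvi : congrLin (A : Matrix (Fin 3) (Fin 3) F) v i = 0) : v = 0 := by
    apply congrLin_injective A
    rw [map_zero]
    refine hi _ (h ▸ (congrLin_mem_congrMap A).2 hv) ?_ hvi
    have : symMat v *ᵥ Pi.single 2 1 = 0 := by
      obtain ⟨-, h2, h5⟩ := hv
      ext i; fin_cases i <;> simp [symMat, h2, h4, h5]
    rw [symMat_congrLin, ← Matrix.mulVec_mulVec, hcancel, ← Matrix.mulVec_mulVec, this,
      Matrix.mulVec_zero]
  set v : Fin 6 → F := ![1, 1, 0, 0, 0, 0] with hv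
  set w : Fin 6 → F := ![0, a, 0, 1, 0, 0] with hw
  have hvU : v ∈ normalPlane 1 a 0 0 := by simp [mem_normalPlane, hv]
  have hwU : w ∈ normalPlane 1 a 0 0 := by simp [mem_normalPlane, hw]
  set s := congrLin (A : Matrix (Fin 3) (Fin 3) F) v i with hs
  set t := congrLin (A : Matrix (Fin 3) (Fin 3) F) w i with ht
  -- This combination has image with vanishing coordinate `i`, so it is zero. Its coordinate 3 is
  -- `-s`; thus `s = 0`, and `v` itself would be zero.
  have h0 := hi' (t • v - s • w)
    (Submodule.sub_mem _ (Submodule.smul_mem _ _ hvU) (Submodule.smul_mem _ _ hwU))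
    (by simp [hv, hw]) (by simp [← hs, ← ht, mul_comm])
  have s0 : s = 0 := by simpa [hv, hw] using congrFun h0 3
  simpa [hv] using congrFun (hi' v hvU rfl s0) 0

lemma orbitK_rep21_ne_rep23 {a a' : F} (ha : a' ≠ 0) :
    orbitK (rep21 a) ≠ orbitK (rep23 a') := by
  intro h
  have hm : rep23 a' ∈ orbitK (rep21 a) := h ▸ MulAction.mem_orbit_self _
  rw [rep21_eq, rep23_eq, mem_orbitK_pointSet_iff] at hm
  obtain ⟨A, hA⟩ := hm
  exact congrMap_normalPlane_21_ne_23 ha A (pointSet_injective hA).symm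

/-! ### Independence of the parameter and assembly of the classification. -/

lemma orbitK_rep21_eq [Fintype F] [CharP F 2] {a a' : F} (ha : absTrace a = 1)
    (ha' : absTrace a' = 1) : orbitK (rep21 a) = orbitK (rep21 a') := by
  obtain ⟨A, hA⟩ := (hasDifferentHyperplanes_21 ha).exists_normalPlane_21 ha'
  rw [rep21_eq, rep21_eq, ← hA, orbitK_pointSet_congrMap]

lemma orbitK_rep23_eq [CharP F 2] {a a' : F} (ha : a ≠ 0) (ha' : a' ≠ 0) :
    orbitK (rep23 a) = orbitK (rep23 a') := by
  obtain ⟨A, hA⟩ := (hasDifferentHyperplanes_23 ha).exists_normalPlane_23 one_ne_zero ha'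
  rw [rep23_eq, rep23_eq, ← hA, orbitK_pointSet_congrMap]

lemma HasDifferentHyperplanes.mem_orbitK [Fintype F] [CharP F 2] {U : Submodule F (Fin 6 → F)}
    (h : HasDifferentHyperplanes U) {a : F} (ha : absTrace a = 1) :
    pointSet U ∈ orbitK (rep21 a) ∨ pointSet U ∈ orbitK (rep22 F) ∨
      pointSet U ∈ orbitK (rep23 a) := by
  obtain ⟨A, b, c, d, e, hA⟩ := h.exists_congrMap_eq_normalPlane
  have hn := hA ▸ h.map A
  have key {V : Submodule F (Fin 6 → F)} {B : GL (Fin 3) F}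
      (hB : congrMap B (normalPlane b c d e) = V) : pointSet U ∈ orbitK (pointSet V) := by
    rw [← hB, ← hA, orbitK_pointSet_congrMap, orbitK_pointSet_congrMap]
    exact MulAction.mem_orbit_self _
  rw [rep21_eq, rep22_eq, rep23_eq]
  by_cases he : e = 0
  · subst he
    by_cases hd : d = 0
    · subst hd
      obtain ⟨B, hB⟩ := hn.exists_normalPlane_21 ha
      exact Or.inl (key hB)
    · obtain ⟨B, hB⟩ := hn.exists_normalPlane_23 hd (ne_zero_of_absTrace_eq_one ha)
      exact Or.inr (Or.inr (key hB))
  · obtain ⟨B, hB⟩ := hn.exists_normalPlane_22 he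
    exact Or.inr (Or.inl (key hB))

lemma HasDifferentHyperplanes.exists_of_mem_orbitK [Finite F] [CharP F 2]
    {U : Submodule F (Fin 6 → F)} (h : HasDifferentHyperplanes U) {S : Set (PG5 F)}
    (hS : S ∈ orbitK (pointSet U)) :
    ∃ W : Subspace5 F, (W : Set (PG5 F)) = S ∧ DifferentHyperplanes W := by
  obtain ⟨A, rfl⟩ := mem_orbitK_pointSet_iff.1 hS
  refine ⟨Submodule.projectivization (congrMap A U), rfl, (differentHyperplanes_iff _).2 ?_⟩
  rw [OrderIso.apply_symm_apply]
  exact h.map A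

end Veronese

open Veronese in
theorem mainTheorem5 (F : Type*) [Field F] [Fintype F] [CharP F 2] :
    ∃ Sigma21 Sigma22 Sigma23 : Set (Set (Veronese.PG5 F)),
      -- the three sets are `K`-orbits, with the given representatives
      (∃ a : F, Veronese.absTrace a = 1) ∧
      (∀ a : F, Veronese.absTrace a = 1 → Sigma21 = Veronese.orbitK (Veronese.rep21 a)) ∧
      Sigma22 = Veronese.orbitK (Veronese.rep22 F) ∧
      (∀ a : F, Veronese.absTrace a = 1 → Sigma23 = Veronese.orbitK (Veronese.rep23 a)) ∧
      -- they are pairwise distinct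
      Sigma21 ≠ Sigma22 ∧ Sigma21 ≠ Sigma23 ∧ Sigma22 ≠ Sigma23 ∧
      -- the planes in question are exactly the members of the three orbits
      (∀ S : Set (Veronese.PG5 F),
        (∃ W : Veronese.Subspace5 F, (W : Set (Veronese.PG5 F)) = S ∧
          Veronese.DifferentHyperplanes W) ↔ S ∈ Sigma21 ∨ S ∈ Sigma22 ∨ S ∈ Sigma23) ∧
      -- point-orbit distributions
      (∀ S ∈ Sigma21, Veronese.OD0 S =
        ![0, 1, 2 * Fintype.card F, Fintype.card F ^ 2 - Fintype.card F]) ∧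
      (∀ S ∈ Sigma22, Veronese.OD0 S = ![0, 1, Fintype.card F, Fintype.card F ^ 2]) ∧
      (∀ S ∈ Sigma23, Veronese.OD0 S =
        ![0, 1, 2 * Fintype.card F, Fintype.card F ^ 2 - Fintype.card F]) := by
  obtain ⟨a, ha⟩ := exists_absTrace_eq_one F
  have ha0 := ne_zero_of_absTrace_eq_one ha
  have od21 (S) (hS : S ∈ orbitK (rep21 a)) : OD0 S =
      ![0, 1, 2 * Fintype.card F, Fintype.card F ^ 2 - Fintype.card F] := by
    rw [OD0_eq_of_mem_orbitK hS, rep21_eq, OD0_21 ha]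
  have od22 (S) (hS : S ∈ orbitK (rep22 F)) : OD0 S =
      ![0, 1, Fintype.card F, Fintype.card F ^ 2] := by
    rw [OD0_eq_of_mem_orbitK hS, rep22_eq, OD0_22]
  have od23 (S) (hS : S ∈ orbitK (rep23 a)) : OD0 S =
      ![0, 1, 2 * Fintype.card F, Fintype.card F ^ 2 - Fintype.card F] := by
    rw [OD0_eq_of_mem_orbitK hS, rep23_eq, OD0_23 ha0]
  have hself : rep22 F ∈ orbitK (rep22 F) := MulAction.mem_orbit_self _
  refine ⟨orbitK (rep21 a), orbitK (rep22 F), orbitK (rep23 a), ⟨a, ha⟩,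
    fun a' ha' => orbitK_rep21_eq ha ha', rfl,
    fun a' ha' => orbitK_rep23_eq ha0 (ne_zero_of_absTrace_eq_one ha'), ?_,
    orbitK_rep21_ne_rep23 ha0, ?_, ?_, od21, od22, od23⟩
  · intro h
    -- Equality of the orbits would give `2q = q`.
    have := congrFun ((od21 _ (h ▸ hself)).symm.trans (od22 _ hself)) 2
    simp at this
  · intro h
    have := congrFun ((od23 _ (h ▸ hself)).symm.trans (od22 _ hself)) 2
    simp at this
  · intro S
    constructor
    · rintro ⟨W, rfl, hW⟩
      rw [← pointSet_submodule]
      exact ((differentHyperplanes_iff W).1 hW).mem_orbitK ha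
    · rw [rep21_eq, rep22_eq, rep23_eq]
      rintro (hS | hS | hS)
      · exact (hasDifferentHyperplanes_21 ha).exists_of_mem_orbitK hS
      · exact hasDifferentHyperplanes_22.exists_of_mem_orbitK hS
      · exact (hasDifferentHyperplanes_23 ha0).exists_of_mem_orbitK hS
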